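/- All Lie algebras are over $\mathbb{C}$. A finite-dimensional classical simple Lie algebra $\mathfrak g$ is one isomorphic to $\mathfrak{sl}(V)$, $\mathfrak{so}(V)$ or $\mathfrak{sp}(V)$ and simple; $V$ is its natural module. An inclusion $\mathfrak g_1\subset\mathfrak g_2$ of classical simple Lie algebras with natural modules $V_1,V_2$ is called diagonal if, as a $\mathfrak g_1$-module, $V_2$ is isomorphic to $$\underbrace{V_1\oplus\dots\oplus V_1}_{l}\oplus\underbrace{V_1^*\oplus\dots\oplus V_1^*}_{r}\oplus\underbrace{T_1\oplus\dots\oplus T_1}_{z}$$ for some $l,r,z\ge 0$, where $T_1$ is the one-dimensional trivial module. A diagonal (locally simple) Lie algebra is a Lie algebra $\mathfrak s$ that is the union of a chain $\mathfrak s_1\subset\mathfrak s_2\subset\cdots$ of finite-dimensional classical simple subalgebras, with fixed natural modules, such that every inclusion $\mathfrak s_i\subset\mathfrak s_{i+1}$ is diagonal. Let $\mathfrak{sl}(\infty)=\bigcup_n\mathfrak{sl}(n)$, $\mathfrak{so}(\infty)=\bigcup_n\mathfrak{so}(n)$ and $\mathfrak{sp}(\infty)=\bigcup_n\mathfrak{sp}(2n)$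 be the finitary Lie algebras (unions under the standard block inclusions). **Corollary.** Let $\mathfrak s$ be an infinite-dimensional diagonal Lie algebra. Then each of the three Lie algebras $\mathfrak{sl}(\infty)$, $\mathfrak{so}(\infty)$ and $\mathfrak{sp}(\infty)$ admits an injective Lie algebra homomorphism into $\mathfrak s$. -/

import Mathlib

attribute [local instance 100] LieRing.ofAssociativeRing

namespace DiagonalLie

/-! ### Natural modules, signatures and diagonal Lie algebras -/

section Diagonal

variable {L : Type*} [LieRing L] [LieAlgebra ℂ L]

/-- `ρ` exhibits the finite-dimensional space `V` as a natural module of `L`: it is an isomorphism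
of `L` onto `sl(V)` (type A), or onto the Lie algebra `so(V, B)` of a nondegenerate symmetric form
(type O), or onto the Lie algebra `sp(V, B)` of a nondegenerate alternating form (type C). -/
def IsNaturalRep {V : Type*} [AddCommGroup V] [Module ℂ V]
    (ρ : L →ₗ⁅ℂ⁆ Module.End ℂ V) : Prop :=
  Function.Injective ρ ∧
    ((∀ f : Module.End ℂ V, f ∈ ρ.range ↔ LinearMap.trace ℂ V f = 0) ∨
      ∃ B : LinearMap.BilinForm ℂ V, B.Nondegenerate ∧ (B.IsSymm ∨ B.IsAlt) ∧
        ρ.range = skewAdjointLieSubalgebra B)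

/-- The `L`-module `V₂` is isomorphic to
`V₁ ⊕ ⋯ ⊕ V₁` (`l` copies) `⊕ V₁* ⊕ ⋯ ⊕ V₁*` (`r` copies) `⊕ T ⊕ ⋯ ⊕ T` (`z` copies), where `V₁*`
is the dual module and `T` is the one-dimensional trivial module. -/
def HasSignature {V₁ V₂ : Type*} [AddCommGroup V₁] [Module ℂ V₁] [AddCommGroup V₂] [Module ℂ V₂]
    (ρ₁ : L →ₗ⁅ℂ⁆ Module.End ℂ V₁) (ρ₂ : L →ₗ⁅ℂ⁆ Module.End ℂ V₂) (l r z : ℕ) : Prop :=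
  ∃ e : V₂ ≃ₗ[ℂ] (Fin l → V₁) × (Fin r → Module.Dual ℂ V₁) × (Fin z → ℂ),
    ∀ (x : L) (v : V₂),
      e (ρ₂ x v) = (fun i => ρ₁ x ((e v).1 i), fun i => -((e v).2.1 i ∘ₗ ρ₁ x), 0)

/-- A complex Lie algebra is diagonal (locally simple) if it is the union of an increasing sequence
of finite-dimensional classical simple subalgebras `S i` with natural modules `ℂ ^ d i`
(given by `ρ i`), every inclusion `S i ⊆ S (i + 1)` being diagonal: the restriction to `S i` of the
natural module of `S (i + 1)` is a sum of copies of the natural module of `S i`, of its dual and of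
the trivial module. -/
def IsDiagonal (L : Type*) [LieRing L] [LieAlgebra ℂ L] : Prop :=
  ∃ (S : ℕ → LieSubalgebra ℂ L) (hS : ∀ i, S i ≤ S (i + 1)) (d : ℕ → ℕ)
    (ρ : ∀ i, S i →ₗ⁅ℂ⁆ Module.End ℂ (Fin (d i) → ℂ)),
    (∀ x : L, ∃ i, x ∈ S i) ∧
    (∀ i, LieAlgebra.IsSimple ℂ (S i)) ∧
    (∀ i, IsNaturalRep (ρ i)) ∧
    ∀ i, ∃ l r z : ℕ,
      HasSignature (ρ i) ((ρ (i + 1)).comp (LieSubalgebra.inclusion (hS i))) l r z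

end Diagonal

/-! ### The finitary Lie algebras

Infinite matrices indexed by `ι` are viewed as endomorphisms of the space `ι →₀ ℂ` with its
standard basis. -/

section Finitary

variable {ι : Type*}

/-- The matrix entry of `f` in row `i` and column `j`. -/
noncomputable def entry (f : Module.End ℂ (ι →₀ ℂ)) (i j : ι) : ℂ :=
  f (Finsupp.single j 1) i

/-- All nonzero entries of the matrix of `f` lie in the block `s × s`. -/
def SupportedOn (s : Finset ι) (f : Module.End ℂ (ι →₀ ℂ)) : Prop :=
  ∀ i j, (i ∉ s ∨ j ∉ s) → entry f i j = 0

theorem entry_zero (i j : ι) : entry 0 i j = 0 := by simp [entry]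

theorem entry_add (f g : Module.End ℂ (ι →₀ ℂ)) (i j : ι) :
    entry (f + g) i j = entry f i j + entry g i j := by simp [entry]

theorem entry_smul (c : ℂ) (f : Module.End ℂ (ι →₀ ℂ)) (i j : ι) :
    entry (c • f) i j = c * entry f i j := by simp [entry]

theorem SupportedOn.mono {s t : Finset ι} {f : Module.End ℂ (ι →₀ ℂ)} (h : SupportedOn s f)
    (hst : s ⊆ t) : SupportedOn t f :=
  fun i j hij => h i j (hij.imp (fun h' h'' => h' (hst h'')) (fun h' h'' => h' (hst h'')))

theorem SupportedOn.zero (s : Finset ι) : SupportedOn s (0 : Module.End ℂ (ι →₀ ℂ)) :=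
  fun i j _ => entry_zero i j

theorem SupportedOn.add {s : Finset ι} {f g : Module.End ℂ (ι →₀ ℂ)} (hf : SupportedOn s f)
    (hg : SupportedOn s g) : SupportedOn s (f + g) :=
  fun i j h => by rw [entry_add, hf i j h, hg i j h, add_zero]

theorem SupportedOn.smul {s : Finset ι} {f : Module.End ℂ (ι →₀ ℂ)} (c : ℂ)
    (hf : SupportedOn s f) : SupportedOn s (c • f) :=
  fun i j h => by rw [entry_smul, hf i j h, mul_zero]

theorem entry_mul {s : Finset ι} {f g : Module.End ℂ (ι →₀ ℂ)} (hg : SupportedOn s g) (i j : ι) :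
    entry (f * g) i j = ∑ k ∈ s, entry f i k * entry g k j := by
  have h : g (Finsupp.single j 1) = ∑ k ∈ s, entry g k j • Finsupp.single k (1 : ℂ) := by
    classical
    ext a
    rw [Finsupp.finsetSum_apply]
    simp only [Finsupp.smul_apply, Finsupp.single_apply, smul_eq_mul, mul_ite, mul_one, mul_zero,
      Finset.sum_ite_eq']
    split_ifs with ha
    · rfl
    · exact hg a j (Or.inl ha)
  rw [entry, Module.End.mul_apply, h, map_sum, Finsupp.finsetSum_apply]
  refine Finset.sum_congr rfl fun k _ => ?_
  rw [map_smul, Finsupp.smul_apply, smul_eq_mul, mul_comm]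
  rfl

theorem entry_commutator {s : Finset ι} {f g : Module.End ℂ (ι →₀ ℂ)} (hf : SupportedOn s f)
    (hg : SupportedOn s g) (i j : ι) :
    entry (f * g - g * f) i j =
      ∑ k ∈ s, entry f i k * entry g k j - ∑ k ∈ s, entry g i k * entry f k j := by
  rw [← entry_mul hg, ← entry_mul hf]
  simp [entry]

theorem SupportedOn.commutator {s : Finset ι} {f g : Module.End ℂ (ι →₀ ℂ)} (hf : SupportedOn s f)
    (hg : SupportedOn s g) : SupportedOn s (f * g - g * f) := by
  intro i j h
  rw [entry_commutator hf hg, Finset.sum_eq_zero, Finset.sum_eq_zero, sub_zero]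
  · intro k _
    rcases h with h | h
    · rw [hg i k (Or.inl h), zero_mul]
    · rw [hf k j (Or.inr h), mul_zero]
  · intro k _
    rcases h with h | h
    · rw [hf i k (Or.inl h), zero_mul]
    · rw [hg k j (Or.inr h), mul_zero]

/-- The Lie algebra of all finitary matrices (finitely many nonzero entries). -/
def glFin (ι : Type*) : LieSubalgebra ℂ (Module.End ℂ (ι →₀ ℂ)) where
  carrier := {f | ∃ s, SupportedOn s f}
  zero_mem' := ⟨∅, SupportedOn.zero _⟩
  add_mem' := by
    classical
    rintro f g ⟨s, hs⟩ ⟨t, ht⟩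
    exact ⟨s ∪ t, (hs.mono Finset.subset_union_left).add (ht.mono Finset.subset_union_right)⟩
  smul_mem' := by
    rintro c f ⟨s, hs⟩
    exact ⟨s, hs.smul c⟩
  lie_mem' := by
    classical
    rintro f g ⟨s, hs⟩ ⟨t, ht⟩
    exact ⟨s ∪ t, (hs.mono Finset.subset_union_left).commutator (ht.mono Finset.subset_union_right)⟩

theorem trace_mono {s t : Finset ι} {f : Module.End ℂ (ι →₀ ℂ)} (h : SupportedOn s f)
    (hst : s ⊆ t) : ∑ i ∈ t, entry f i i = ∑ i ∈ s, entry f i i :=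
  (Finset.sum_subset hst fun i _ hi => h i i (Or.inl hi)).symm

/-- The Lie algebra of all finitary matrices of trace zero, i.e. the union of the Lie algebras
`sl(s)` over the finite sets `s` of indices. -/
def slFin (ι : Type*) : LieSubalgebra ℂ (Module.End ℂ (ι →₀ ℂ)) where
  carrier := {f | ∃ s, SupportedOn s f ∧ ∑ i ∈ s, entry f i i = 0}
  zero_mem' := ⟨∅, SupportedOn.zero _, by simp⟩
  add_mem' := by
    classical
    rintro f g ⟨s, hs, hs'⟩ ⟨t, ht, ht'⟩
    refine ⟨s ∪ t,
      (hs.mono Finset.subset_union_left).add (ht.mono Finset.subset_union_right), ?_⟩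
    simp only [entry_add, Finset.sum_add_distrib]
    rw [trace_mono hs Finset.subset_union_left, trace_mono ht Finset.subset_union_right, hs', ht',
      add_zero]
  smul_mem' := by
    rintro c f ⟨s, hs, hs'⟩
    refine ⟨s, hs.smul c, ?_⟩
    simp only [entry_smul, ← Finset.mul_sum, hs', mul_zero]
  lie_mem' := by
    classical
    rintro f g ⟨s, hs, -⟩ ⟨t, ht, -⟩
    have hf := hs.mono (Finset.subset_union_left (s₂ := t))
    have hg := ht.mono (Finset.subset_union_right (s₁ := s))
    refine ⟨s ∪ t, hf.commutator hg, ?_⟩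
    change ∑ i ∈ s ∪ t, entry (f * g - g * f) i i = 0
    simp only [entry_commutator hf hg, Finset.sum_sub_distrib]
    rw [Finset.sum_comm, sub_eq_zero]
    exact Finset.sum_congr rfl fun i _ => Finset.sum_congr rfl fun j _ => mul_comm _ _

/-- The bilinear form on `ι →₀ ℂ` with Gram matrix `J` in the standard basis. -/
noncomputable def gramForm (J : Matrix ι ι ℂ) : LinearMap.BilinForm ℂ (ι →₀ ℂ) :=
  Finsupp.linearCombination ℂ fun i => Finsupp.linearCombination ℂ fun j => J i j

end Finitary

/-- `sl(∞)`: the union of the Lie algebras `sl(n)` under the inclusions as upper left blocks. -/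
abbrev slInf : LieSubalgebra ℂ (Module.End ℂ (ℕ →₀ ℂ)) := slFin ℕ

/-- `so(∞)`: the union of the Lie algebras `so(n)` of skew-symmetric matrices, i.e. the finitary
matrices that are skew-adjoint for the symmetric form `∑ xᵢ yᵢ`. -/
noncomputable abbrev soInf : LieSubalgebra ℂ (Module.End ℂ (ℕ →₀ ℂ)) :=
  glFin ℕ ⊓ skewAdjointLieSubalgebra (gramForm (1 : Matrix ℕ ℕ ℂ))

/-- `sp(∞)`: the union of the Lie algebras `sp(2n)`, i.e. the finitary matrices that are
skew-adjoint for the standard symplectic form; the basis is indexed by two copies of `ℕ`. -/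
noncomputable abbrev spInf : LieSubalgebra ℂ (Module.End ℂ (ℕ ⊕ ℕ →₀ ℂ)) :=
  glFin (ℕ ⊕ ℕ) ⊓ skewAdjointLieSubalgebra (gramForm (Matrix.J ℕ ℂ))

end DiagonalLie

/-! All three finitary algebras embed in the Lie algebra of finitary infinite matrices, `sp(∞)`
after a bijection between two copies of `ℕ` and `ℕ`. It therefore suffices to find in `𝔰` linearly
independent elements `z a b`, `a b : ℕ`, with the brackets of matrix units (`IsGlUnits`); they are
built as a limit of finite systems.

The three classical types are treated alike by letting `gl(n)` act on a natural module as `ℂⁿ ⊕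
(ℂⁿ)*` plus a trivial part (`Frame`, `HypUnits`): such operators have trace zero, and they are
skew-adjoint as soon as the two summands are isotropic and dual to each other for the form. Along a
diagonal inclusion of multiplicity `l + r`, units indexed by `ι` become block sums of units indexed
by `ι × (Fin l ⊕ Fin r)` (`HypUnits.exists_lift`).

If the multiplicities are eventually `1`, lifting leaves the size of the system unchanged while the
natural modules grow, so there is room to add one index at a time (`HypUnits.exists_extend`).

Otherwise the multiplicities have unbounded products, and there may be no trivial summands to extend
into. Then `gl(n)` is embedded in a larger `gl(N)` through a sum of exterior powers `Λ^j(ℂⁿ)` taken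
`m j` times. Since `Λ^j(ℂⁿ⁺¹)` restricts to `Λ^j(ℂⁿ) ⊕ Λ^(j-1)(ℂⁿ)`, this extends to `gl(n + 1)`
across an inclusion of multiplicity `k` once `m' j + m' (j + 1) = k * m j`. Positive integer
solutions come from moments: the integrals of `x ^ j * (1 - x) ^ (n - j)` against a positive density
satisfy the recurrence with `k = 1`, and for large `k` a small change of the density makes the
scaled values integral (`IsMomentSystem.exists_step`). -/

namespace DiagonalLie

/-! ### Matrix units and embeddings of finitary matrices -/

section MatrixUnits

variable {ι κ L : Type*} [LieRing L] [LieAlgebra ℂ L]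

/-- The elements `z a b` of `L` are linearly independent and multiply like the matrix units
of the general linear Lie algebra. -/
structure IsGlUnits [DecidableEq ι] (z : ι → ι → L) : Prop where
  lie : ∀ a b c d, ⁅z a b, z c d⁆ = (if b = c then z a d else 0) - (if d = a then z c b else 0)
  linearIndependent : LinearIndependent ℂ fun p : ι × ι => z p.1 p.2

/-- The element of `L` corresponding to the `s × s` block of the matrix `x`. -/
def blockSum (z : ι → ι → L) (s : Finset ι) (x : ι → ι → ℂ) : L :=
  ∑ a ∈ s, ∑ b ∈ s, x a b • z a b

theorem blockSum_add (z : ι → ι → L) (s : Finset ι) (x y : ι → ι → ℂ) :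
    blockSum z s (fun a b => x a b + y a b) = blockSum z s x + blockSum z s y := by
  simp [blockSum, add_smul, Finset.sum_add_distrib]

theorem blockSum_smul (z : ι → ι → L) (s : Finset ι) (c : ℂ) (x : ι → ι → ℂ) :
    blockSum z s (fun a b => c * x a b) = c • blockSum z s x := by
  simp [blockSum, mul_smul, Finset.smul_sum]

theorem blockSum_mono (z : ι → ι → L) {s t : Finset ι} (hst : s ⊆ t) {x : ι → ι → ℂ}
    (hx : ∀ a b, a ∉ s ∨ b ∉ s → x a b = 0) : blockSum z t x = blockSum z s x := by
  unfold blockSum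
  symm
  rw [Finset.sum_subset hst]
  · refine Finset.sum_congr rfl fun a _ => Finset.sum_subset hst fun b _ hb => ?_
    rw [hx a b (Or.inr hb), zero_smul]
  · intro a _ ha
    refine Finset.sum_eq_zero fun b _ => ?_
    rw [hx a b (Or.inl ha), zero_smul]

theorem IsGlUnits.lie_blockSum [DecidableEq ι] {z : ι → ι → L} (hz : IsGlUnits z) (s : Finset ι)
    (x y : ι → ι → ℂ) : ⁅blockSum z s x, blockSum z s y⁆ =
      blockSum z s fun a b => ∑ k ∈ s, x a k * y k b - ∑ k ∈ s, y a k * x k b := by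
  have h1 : ⁅blockSum z s x, blockSum z s y⁆ = ∑ a ∈ s, ∑ b ∈ s, ∑ c ∈ s, ∑ d ∈ s,
      ((x a b * y c d) • (if b = c then z a d else 0) -
        (x a b * y c d) • (if d = a then z c b else 0)) := by
    rw [blockSum, blockSum, sum_lie]
    refine Finset.sum_congr rfl fun a _ => ?_
    rw [sum_lie]
    refine Finset.sum_congr rfl fun b _ => ?_
    rw [lie_sum]
    refine Finset.sum_congr rfl fun c _ => ?_
    rw [lie_sum]
    refine Finset.sum_congr rfl fun d _ => ?_
    rw [smul_lie, lie_smul, hz.lie, smul_smul, smul_sub]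
  rw [h1]
  simp only [Finset.sum_sub_distrib, blockSum, sub_smul, Finset.sum_smul]
  congr 1
  · refine Finset.sum_congr rfl fun a _ => ?_
    have : ∀ b ∈ s, (∑ c ∈ s, ∑ d ∈ s, (x a b * y c d) • (if b = c then z a d else 0)) =
        ∑ d ∈ s, (x a b * y b d) • z a d := by
      intro b hb
      rw [Finset.sum_eq_single b]
      · simp
      · intro c _ hc
        simp [hc.symm]
      · simp [hb]
    rw [Finset.sum_congr rfl this, Finset.sum_comm]
  · have : ∀ a ∈ s, ∀ b ∈ s, (∑ c ∈ s, ∑ d ∈ s,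
        (x a b * y c d) • (if d = a then z c b else 0)) = ∑ c ∈ s, (y c a * x a b) • z c b := by
      intro a ha b _
      refine Finset.sum_congr rfl fun c _ => ?_
      rw [Finset.sum_eq_single a]
      · simp [mul_comm]
      · intro d _ hd
        simp [hd]
      · simp [ha]
    rw [Finset.sum_congr rfl fun a ha => Finset.sum_congr rfl (this a ha)]
    calc ∑ a ∈ s, ∑ b ∈ s, ∑ c ∈ s, (y c a * x a b) • z c b
        = ∑ a ∈ s, ∑ c ∈ s, ∑ b ∈ s, (y c a * x a b) • z c b :=
          Finset.sum_congr rfl fun a _ => Finset.sum_comm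
      _ = ∑ c ∈ s, ∑ a ∈ s, ∑ b ∈ s, (y c a * x a b) • z c b := Finset.sum_comm
      _ = _ := Finset.sum_congr rfl fun a _ => Finset.sum_comm

theorem IsGlUnits.blockSum_eq_zero [DecidableEq ι] {z : ι → ι → L} (hz : IsGlUnits z) {s : Finset ι}
    {x : ι → ι → ℂ} (h : blockSum z s x = 0) {a b : ι} (ha : a ∈ s) (hb : b ∈ s) :
    x a b = 0 := by
  have := linearIndependent_iff'.1 hz.linearIndependent (s ×ˢ s) (fun p => x p.1 p.2)
    (by rw [Finset.sum_product]; exact h) (a, b) (by simp [ha, hb])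
  exact this

theorem IsGlUnits.comp_injective [DecidableEq ι] [DecidableEq κ] {z : ι → ι → L}
    (hz : IsGlUnits z) {f : κ → ι} (hf : Function.Injective f) : IsGlUnits fun a b => z (f a) (f b) where
  lie a b c d := by simp [hz.lie, hf.eq_iff]
  linearIndependent := hz.linearIndependent.comp (fun p : κ × κ => (f p.1, f p.2))
    fun p q h => by
      simp only [Prod.mk.injEq] at h
      exact Prod.ext (hf h.1) (hf h.2)

theorem exists_lieHom_glFin [DecidableEq ι] {z : ι → ι → L} (hz : IsGlUnits z) :
    ∃ φ : glFin ι →ₗ⁅ℂ⁆ L, Function.Injective φ := by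
  -- The supporting block is an arbitrary choice; `hF` shows that any other block gives the same
  -- value.
  let F : glFin ι → L := fun f => blockSum z f.2.choose (entry f.1)
  have hF : ∀ (f : glFin ι) (s : Finset ι), SupportedOn s f.1 →
      F f = blockSum z s (entry f.1) := by
    intro f s hs
    rw [← blockSum_mono z (Finset.subset_union_left (s₂ := f.2.choose)) hs,
      blockSum_mono z (Finset.subset_union_right (s₁ := s)) f.2.choose_spec]
  have h2 : ∀ f g : glFin ι, ∃ s, SupportedOn s f.1 ∧ SupportedOn s g.1 := by
    rintro ⟨f, s, hs⟩ ⟨g, t, ht⟩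
    exact ⟨s ∪ t, hs.mono Finset.subset_union_left, ht.mono Finset.subset_union_right⟩
  let φ : glFin ι →ₗ⁅ℂ⁆ L :=
    { toFun := F
      map_add' := by
        intro f g
        obtain ⟨s, hf, hg⟩ := h2 f g
        rw [hF f s hf, hF g s hg, hF (f + g) s (hf.add hg), ← blockSum_add]
        congr 1
      map_smul' := by
        intro c f
        obtain ⟨s, hf, -⟩ := h2 f f
        rw [hF f s hf, hF (c • f) s (hf.smul c), RingHom.id_apply, ← blockSum_smul]
        congr 1
      map_lie' := by
        intro f g
        obtain ⟨s, hf, hg⟩ := h2 f g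
        rw [hF f s hf, hF g s hg, hF ⁅f, g⁆ s (hf.commutator hg), hz.lie_blockSum]
        congr 1
        ext a b
        exact entry_commutator hf hg a b }
  refine ⟨φ, (injective_iff_map_eq_zero φ).2 fun f hf => ?_⟩
  obtain ⟨s, hs, -⟩ := h2 f f
  have h0 : blockSum z s (entry f.1) = 0 := by rw [← hF f s hs]; exact hf
  apply Subtype.ext
  refine Finsupp.lhom_ext' fun j => LinearMap.ext_ring (Finsupp.ext fun i => ?_)
  change entry f.1 i j = 0
  by_cases h : i ∉ s ∨ j ∉ s
  · exact hs i j h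
  · push Not at h
    exact hz.blockSum_eq_zero h0 h.1 h.2

theorem slFin_le_glFin (ι : Type*) : slFin ι ≤ glFin ι := fun _ ⟨s, hs, _⟩ => ⟨s, hs⟩

theorem exists_lieHom_of_isGlUnits {z : ℕ → ℕ → L} (hz : IsGlUnits z) :
    (∃ φ : slInf →ₗ⁅ℂ⁆ L, Function.Injective φ) ∧
    (∃ φ : soInf →ₗ⁅ℂ⁆ L, Function.Injective φ) ∧
    (∃ φ : spInf →ₗ⁅ℂ⁆ L, Function.Injective φ) := by
  obtain ⟨φ, hφ⟩ := exists_lieHom_glFin hz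
  obtain ⟨ψ, hψ⟩ := exists_lieHom_glFin
    (hz.comp_injective (f := Equiv.natSumNatEquivNat) Equiv.natSumNatEquivNat.injective)
  refine ⟨⟨φ.comp (LieSubalgebra.inclusion (slFin_le_glFin ℕ)), ?_⟩,
    ⟨φ.comp (LieSubalgebra.inclusion inf_le_left), ?_⟩,
    ⟨ψ.comp (LieSubalgebra.inclusion inf_le_left), ?_⟩⟩
  · exact hφ.comp (LieSubalgebra.inclusion_injective _)
  · exact hφ.comp (LieSubalgebra.inclusion_injective _)
  · exact hψ.comp (LieSubalgebra.inclusion_injective _)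

/-- A coherent sequence of finite systems of matrix units has a limit. -/
theorem exists_isGlUnits_of_coherent (ζ : ℕ → ℕ → ℕ → L)
    (hζ : ∀ n, IsGlUnits fun a b : Fin n => ζ n a b)
    (hc : ∀ n a b, a < n → b < n → ζ (n + 1) a b = ζ n a b) :
    ∃ z : ℕ → ℕ → L, IsGlUnits z := by
  have hs : ∀ n m a b, n ≤ m → a < n → b < n → ζ m a b = ζ n a b := by
    intro n m a b hnm ha hb
    induction m, hnm using Nat.le_induction with
    | base => rfl
    | succ m hm ih => rw [hc m a b (by omega) (by omega), ih]
  -- Size `a + b + 1` exceeds both indices, so the entry is already stable there.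
  let z : ℕ → ℕ → L := fun a b => ζ (a + b + 1) a b
  have hzn : ∀ n a b, a < n → b < n → z a b = ζ n a b := by
    intro n a b ha hb
    rw [← hs n (n + (a + b + 1)) a b (by omega) ha hb,
      hs (a + b + 1) (n + (a + b + 1)) a b (by omega) (by omega) (by omega)]
  refine ⟨z, ?_, ?_⟩
  · intro a b c d
    let n := a + b + c + d + 1
    have h := (hζ n).lie ⟨a, by omega⟩ ⟨b, by omega⟩ ⟨c, by omega⟩ ⟨d, by omega⟩
    simp only [Fin.mk.injEq] at h
    rw [hzn n a b, hzn n c d, hzn n a d, hzn n c b, h] <;> omega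
  · rw [linearIndependent_iff']
    intro s g hg p hp
    obtain ⟨n, hn⟩ : ∃ n, ∀ q ∈ s, q.1 < n ∧ q.2 < n := by
      refine ⟨s.sup (fun q => q.1 + q.2) + 1, fun q hq => ?_⟩
      have := Finset.le_sup (f := fun q : ℕ × ℕ => q.1 + q.2) hq
      omega
    classical
    have key := (hζ n).blockSum_eq_zero (s := Finset.univ)
      (x := fun a b => if ((a : ℕ), (b : ℕ)) ∈ s then g (a, b) else 0) (by
        rw [← hg, blockSum, ← Finset.sum_product']
        simp only [ite_smul, zero_smul]
        rw [← Finset.sum_filter]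
        refine Finset.sum_bij (fun q _ => ((q.1 : ℕ), (q.2 : ℕ))) ?_ ?_ ?_ ?_
        · intro q hq
          exact (Finset.mem_filter.1 hq).2
        · intro q _ q' _ h
          simp only [Prod.mk.injEq] at h
          exact Prod.ext (Fin.ext h.1) (Fin.ext h.2)
        · intro q hq
          exact ⟨(⟨q.1, (hn q hq).1⟩, ⟨q.2, (hn q hq).2⟩), by simp [hq], rfl⟩
        · intro q _
          rw [hzn n q.1 q.2 q.1.2 q.2.2])
      (Finset.mem_univ ⟨p.1, (hn p hp).1⟩) (Finset.mem_univ ⟨p.2, (hn p hp).2⟩)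
    simpa [hp] using key

end MatrixUnits

/-! ### Frames, and how they fit a classical Lie algebra -/

section Frames

variable {ι κ L V : Type*} [LieRing L] [LieAlgebra ℂ L] [AddCommGroup V] [Module ℂ V]

theorem mem_skewAdjointLieSubalgebra_iff {B : LinearMap.BilinForm ℂ V} {f : Module.End ℂ V} :
    f ∈ skewAdjointLieSubalgebra B ↔ ∀ x y, B (f x) y = -B x (f y) := by
  change f ∈ B.skewAdjointSubmodule ↔ _
  rw [LinearMap.mem_skewAdjointSubmodule]
  refine forall_congr' fun x => forall_congr' fun y => ?_
  simp

/-- Two families of vectors of `V` together with biorthogonal families of functionals, i.e. an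
embedding of `ℂ ^ ι × ℂ ^ ι` as a direct summand of `V`. -/
structure Frame (ι V : Type*) [DecidableEq ι] [AddCommGroup V] [Module ℂ V] where
  /-- the basis of the first summand -/
  u : ι → V
  /-- the basis of the second summand -/
  w : ι → V
  /-- the functionals dual to `u` -/
  u' : ι → Module.Dual ℂ V
  /-- the functionals dual to `w` -/
  w' : ι → Module.Dual ℂ V
  u'_u : ∀ a b, u' a (u b) = if a = b then 1 else 0
  w'_w : ∀ a b, w' a (w b) = if a = b then 1 else 0
  u'_w : ∀ a b, u' a (w b) = 0
  w'_u : ∀ a b, w' a (u b) = 0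

/-- The matrix unit `E a b` acting on the first summand as `E a b`, on the second one as the
negative transpose, and by zero on the common kernel of the functionals. -/
def Frame.unit [DecidableEq ι] (F : Frame ι V) (a b : ι) : Module.End ℂ V :=
  (F.u' b).smulRight (F.u a) - (F.w' a).smulRight (F.w b)

theorem Frame.unit_apply [DecidableEq ι] (F : Frame ι V) (a b : ι) (v : V) :
    F.unit a b v = F.u' b v • F.u a - F.w' a v • F.w b := rfl

theorem Frame.lie_unit [DecidableEq ι] (F : Frame ι V) (a b c d : ι) :
    ⁅F.unit a b, F.unit c d⁆ =
      (if b = c then F.unit a d else 0) - (if d = a then F.unit c b else 0) := by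
  ext v
  rw [LieRing.of_associative_ring_bracket]
  rcases eq_or_ne b c with rfl | h1 <;> rcases eq_or_ne d a with rfl | h2 <;>
    simp [Frame.unit_apply, F.u'_u, F.w'_w, F.u'_w, F.w'_u, *, Ne.symm] <;> abel

/-- The elements `y a b` of `L` act on the module `V` as the matrix units of a frame. -/
def HypUnits [DecidableEq ι] (ρ : L →ₗ⁅ℂ⁆ Module.End ℂ V) (y : ι → ι → L) : Prop :=
  ∃ F : Frame ι V, ∀ a b, ρ (y a b) = F.unit a b

/-- The module is faithful, so the brackets can be checked on operators; pairing with `u' p.1` after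
applying to `u p.2` isolates the coefficient of the unit `p`. -/
theorem HypUnits.isGlUnits [DecidableEq ι] {ρ : L →ₗ⁅ℂ⁆ Module.End ℂ V}
    (hρ : Function.Injective ρ) {y : ι → ι → L} (hy : HypUnits ρ y) : IsGlUnits y := by
  obtain ⟨F, hF⟩ := hy
  constructor
  · intro a b c d
    apply hρ
    rw [LieHom.map_lie, hF, hF, F.lie_unit, map_sub]
    congr 1 <;> split_ifs <;> simp [hF]
  · rw [linearIndependent_iff']
    intro s g hg p hp
    have h := congrArg (fun x => F.u' p.1 (ρ x (F.u p.2))) hg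
    simp only [map_sum, map_smul, hF, LinearMap.sum_apply, LinearMap.smul_apply,
      F.unit_apply, F.u'_u, F.w'_u, zero_smul, sub_zero, LinearMap.zero_apply,
      map_zero, map_smul, smul_eq_mul] at h
    rw [Finset.sum_eq_single p] at h
    · simpa using h
    · intro q _ hq
      by_cases h1 : q.2 = p.2
      · have h2 : p.1 ≠ q.1 := fun h2 => hq (Prod.ext h2.symm h1)
        simp [h2]
      · simp [h1]
    · exact fun h => (h hp).elim

theorem HypUnits.comp_injective [DecidableEq ι] [DecidableEq κ] {ρ : L →ₗ⁅ℂ⁆ Module.End ℂ V}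
    {y : ι → ι → L} (hy : HypUnits ρ y) {f : κ → ι} (hf : Function.Injective f) :
    HypUnits ρ fun a b => y (f a) (f b) := by
  obtain ⟨F, hF⟩ := hy
  exact ⟨⟨fun a => F.u (f a), fun a => F.w (f a), fun a => F.u' (f a), fun a => F.w' (f a),
    by simp [F.u'_u, hf.eq_iff], by simp [F.w'_w, hf.eq_iff], by simp [F.u'_w],
    by simp [F.w'_u]⟩, fun a b => hF _ _⟩

/-- A linear combination of the matrix units of a frame. -/
def Frame.comb [DecidableEq ι] [Fintype ι] (F : Frame ι V) (c : ι → ι → ℂ) : Module.End ℂ V :=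
  ∑ a, ∑ b, c a b • F.unit a b

theorem Frame.comb_apply [DecidableEq ι] [Fintype ι] (F : Frame ι V) (c : ι → ι → ℂ) (v : V) :
    F.comb c v = (∑ a, ∑ b, (c a b * F.u' b v) • F.u a) -
      ∑ a, ∑ b, (c a b * F.w' a v) • F.w b := by
  simp [Frame.comb, LinearMap.sum_apply, F.unit_apply, smul_sub, smul_smul,
    Finset.sum_sub_distrib]

/-- The grading element of a frame. -/
def Frame.grading [DecidableEq ι] [Fintype ι] (F : Frame ι V) : Module.End ℂ V :=
  ∑ a, F.unit a a

theorem Frame.grading_apply [DecidableEq ι] [Fintype ι] (F : Frame ι V) (v : V) :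
    F.grading v = ∑ a, F.u' a v • F.u a - ∑ a, F.w' a v • F.w a := by
  simp [Frame.grading, LinearMap.sum_apply, F.unit_apply, Finset.sum_sub_distrib]

theorem Frame.grading_u [DecidableEq ι] [Fintype ι] (F : Frame ι V) (a : ι) :
    F.grading (F.u a) = F.u a := by
  simp [F.grading_apply, F.u'_u, F.w'_u]

theorem Frame.grading_w [DecidableEq ι] [Fintype ι] (F : Frame ι V) (a : ι) :
    F.grading (F.w a) = -F.w a := by
  simp [F.grading_apply, F.u'_w, F.w'_w]

theorem Frame.u'_grading [DecidableEq ι] [Fintype ι] (F : Frame ι V) (a : ι) (v : V) :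
    F.u' a (F.grading v) = F.u' a v := by
  simp [F.grading_apply, F.u'_u, F.u'_w]

theorem Frame.w'_grading [DecidableEq ι] [Fintype ι] (F : Frame ι V) (a : ι) (v : V) :
    F.w' a (F.grading v) = -F.w' a v := by
  simp [F.grading_apply, F.w'_u, F.w'_w]

theorem bilin_comm_smul {B : LinearMap.BilinForm ℂ V} (hB : B.IsSymm ∨ B.IsAlt) :
    ∃ ε : ℂ, ε * ε = 1 ∧ ∀ x y, B x y = ε * B y x := by
  rcases hB with hB | hB
  · exact ⟨1, by simp, fun x y => by rw [one_mul, hB.eq x y]⟩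
  · exact ⟨-1, by simp, fun x y => by rw [neg_one_mul, hB.neg_eq]⟩

/-- A frame is hyperbolic for a form if each `w a` is the functional `u' a` and each `u a` is the
functional `w' a`, in terms of the form. -/
def Frame.IsHyperbolic [DecidableEq ι] (F : Frame ι V) (B : LinearMap.BilinForm ℂ V) : Prop :=
  (∀ a v, F.u' a v = B v (F.w a)) ∧ ∀ a v, F.w' a v = B (F.u a) v

theorem Frame.IsHyperbolic.unit_mem [DecidableEq ι] {F : Frame ι V} {B : LinearMap.BilinForm ℂ V}
    (hF : F.IsHyperbolic B) (hB : B.IsSymm ∨ B.IsAlt) (a b : ι) :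
    F.unit a b ∈ skewAdjointLieSubalgebra B := by
  obtain ⟨ε, hε, hs⟩ := bilin_comm_smul hB
  rw [mem_skewAdjointLieSubalgebra_iff]
  intro x y
  simp only [F.unit_apply, hF.1, hF.2, map_sub, map_smul, LinearMap.sub_apply,
    LinearMap.smul_apply, smul_eq_mul]
  rw [hs (F.w b) y, hs x (F.u a)]
  ring

/-- The grading element `h` acts by `1` on the `u a` and by `-1` on the `w a`. If `h` is
skew-adjoint, each of these eigenspaces is isotropic and they are paired with each other. Hence `u`
can be kept, and each `w a` replaced by the vector representing `u' a`. Combinations that were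
skew-adjoint already are determined by their action on the `u` side, so they survive. -/
theorem Frame.exists_isHyperbolic [DecidableEq ι] [Fintype ι] [FiniteDimensional ℂ V]
    (F : Frame ι V) {B : LinearMap.BilinForm ℂ V} (hB : B.Nondegenerate)
    (hs : B.IsSymm ∨ B.IsAlt) (hF : F.grading ∈ skewAdjointLieSubalgebra B) :
    ∃ G : Frame ι V, G.IsHyperbolic B ∧
      ∀ c, F.comb c ∈ skewAdjointLieSubalgebra B → F.comb c = G.comb c := by
  obtain ⟨ε, hε, hsw⟩ := bilin_comm_smul hs
  rw [mem_skewAdjointLieSubalgebra_iff] at hF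
  obtain ⟨w, hw⟩ : ∃ w : ι → V, ∀ a v, B v (w a) = F.u' a v := by
    refine ⟨fun a => (B.toDual hB).symm (ε • F.u' a), fun a v => ?_⟩
    rw [hsw, LinearMap.BilinForm.apply_toDual_symm_apply, LinearMap.smul_apply, smul_eq_mul,
      ← mul_assoc, hε, one_mul]
  have hgw : ∀ a, F.grading (w a) = -w a := by
    intro a
    refine eq_neg_of_add_eq_zero_left (hB.2 _ fun v => ?_)
    rw [map_add, hw, ← neg_eq_iff_eq_neg.2 (hF v (w a)), hw, F.u'_grading, neg_add_cancel]
  have huu : ∀ a b, B (F.u a) (F.u b) = 0 := by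
    intro a b
    have := hF (F.u a) (F.u b)
    rw [F.grading_u, F.grading_u] at this
    linear_combination this / 2
  have hww : ∀ a b, B (w a) (w b) = 0 := by
    intro a b
    have := hF (w a) (w b)
    rw [hgw, hgw, map_neg, map_neg, LinearMap.neg_apply] at this
    linear_combination -this / 2
  let G : Frame ι V :=
    { u := F.u
      w := w
      u' := F.u'
      w' := fun a => B (F.u a)
      u'_u := F.u'_u
      w'_w := fun a b => by rw [hw, F.u'_u]; simp [eq_comm]
      u'_w := fun a b => by rw [← hw, hww]
      w'_u := huu }
  have hG : G.IsHyperbolic B := ⟨fun a v => (hw a v).symm, fun a v => rfl⟩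
  refine ⟨G, hG, fun c hc => ?_⟩
  have hGc : G.comb c ∈ skewAdjointLieSubalgebra B :=
    sum_mem fun a _ => sum_mem fun b _ =>
      (skewAdjointLieSubalgebra B).smul_mem _ (hG.unit_mem hs a b)
  have hD := mem_skewAdjointLieSubalgebra_iff.1 (sub_mem hc hGc)
  have hDv : ∀ v, (F.comb c - G.comb c) v =
      (∑ a, ∑ b, (c a b * B (F.u a) v) • w b) - ∑ a, ∑ b, (c a b * F.w' a v) • F.w b := by
    intro v
    rw [LinearMap.sub_apply, F.comb_apply, G.comb_apply]
    abel
  have h1 : ∀ v, F.grading ((F.comb c - G.comb c) v) = -(F.comb c - G.comb c) v := by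
    intro v
    rw [hDv]
    simp [F.grading_w, hgw, add_comm, sub_eq_add_neg]
  have h2 : ∀ v, (F.comb c - G.comb c) (F.grading v) = -(F.comb c - G.comb c) v := by
    intro v
    have : ∀ a, B (F.u a) (F.grading v) = -B (F.u a) v := by
      intro a
      rw [← neg_eq_iff_eq_neg.2 (hF (F.u a) v), F.grading_u]
    rw [hDv, hDv]
    simp [this, F.w'_grading, add_comm, sub_eq_add_neg]
  -- The difference `D` satisfies `hD = -D` and `Dh = -D`. Skew-adjointness of `h` gives `B (D v) x
  -- = B (D v) (h x)`, that of `D` gives `B (D v) (h x) = -B (D v) x`; hence `D = 0`.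
  refine sub_eq_zero.1 (LinearMap.ext fun v => hB.1 _ fun x => ?_)
  have e1 := hF ((F.comb c - G.comb c) v) x
  have e2 := hD v (F.grading x)
  rw [h1, map_neg, LinearMap.neg_apply] at e1
  rw [h2, map_neg, neg_neg, ← neg_eq_iff_eq_neg.2 (hD v x)] at e2
  linear_combination (e2 - e1) / 2

/-- The dual summand cancels the trace of `E a a` on the first one, so type A imposes no condition
on a frame. -/
theorem Frame.trace_unit [DecidableEq ι] [FiniteDimensional ℂ V] (F : Frame ι V) (a b : ι) :
    LinearMap.trace ℂ V (F.unit a b) = 0 := by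
  rw [Frame.unit, map_sub, LinearMap.trace_smulRight, LinearMap.trace_smulRight, F.u'_u, F.w'_w]
  simp [eq_comm]

/-- If the grading element of a frame belongs to a classical Lie algebra, then the frame can be
changed so that all matrix units do, without changing the linear combinations of matrix units
which are in the Lie algebra already. -/
theorem IsNaturalRep.exists_hypUnits [DecidableEq ι] [Fintype ι] [FiniteDimensional ℂ V]
    {ρ : L →ₗ⁅ℂ⁆ Module.End ℂ V} (hρ : IsNaturalRep ρ) (F : Frame ι V)
    (hF : F.grading ∈ ρ.range) :
    ∃ y : ι → ι → L, HypUnits ρ y ∧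
      ∀ c x, ρ x = F.comb c → x = ∑ a, ∑ b, c a b • y a b := by
  obtain ⟨hinj, h⟩ := hρ
  suffices H : ∃ G : Frame ι V, (∀ a b, G.unit a b ∈ ρ.range) ∧
      ∀ c, F.comb c ∈ ρ.range → F.comb c = G.comb c by
    obtain ⟨G, hG, hc⟩ := H
    choose y hy using hG
    refine ⟨y, ⟨G, hy⟩, fun c x hx => hinj ?_⟩
    rw [hx, hc c ⟨x, hx⟩]
    simp [Frame.comb, ← hy, map_sum]
  rcases h with h | ⟨B, hB, hs, h⟩
  · exact ⟨F, fun a b => (h _).2 (F.trace_unit a b), fun _ _ => rfl⟩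
  · rw [h] at hF ⊢
    obtain ⟨G, hG, hc⟩ := F.exists_isHyperbolic hB hs hF
    exact ⟨G, hG.unit_mem hs, hc⟩

end Frames

/-! ### Lifting matrix units along a diagonal inclusion -/

section Lift

variable {ι L V : Type*} [LieRing L] [LieAlgebra ℂ L] [AddCommGroup V] [Module ℂ V]
variable {L' V' : Type*} [LieRing L'] [LieAlgebra ℂ L'] [AddCommGroup V'] [Module ℂ V']

/-- The frame induced on a sum of copies of `V`, of its dual and of trivial modules. -/
noncomputable def Frame.signatureSum [DecidableEq ι] (F : Frame ι V) {l r z : ℕ}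
    (e : V' ≃ₗ[ℂ] (Fin l → V) × (Fin r → Module.Dual ℂ V) × (Fin z → ℂ)) :
    Frame (ι × (Fin l ⊕ Fin r)) V' where
  -- In a copy of the dual module, the functionals `w'` transform like the vectors `u`, and `u'`
  -- like `w`, so the two halves of the frame trade places.
  u p := p.2.elim (fun s => e.symm (Pi.single s (F.u p.1), 0, 0))
    fun t => e.symm (0, Pi.single t (F.w' p.1), 0)
  w p := p.2.elim (fun s => e.symm (Pi.single s (F.w p.1), 0, 0))
    fun t => e.symm (0, Pi.single t (F.u' p.1), 0)
  u' p := p.2.elim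
    (fun s => F.u' p.1 ∘ₗ LinearMap.proj s ∘ₗ LinearMap.fst ℂ _ _ ∘ₗ e.toLinearMap)
    fun t => LinearMap.applyₗ (F.w p.1) ∘ₗ LinearMap.proj t ∘ₗ LinearMap.fst ℂ _ _ ∘ₗ
      LinearMap.snd ℂ _ _ ∘ₗ e.toLinearMap
  w' p := p.2.elim
    (fun s => F.w' p.1 ∘ₗ LinearMap.proj s ∘ₗ LinearMap.fst ℂ _ _ ∘ₗ e.toLinearMap)
    fun t => LinearMap.applyₗ (F.u p.1) ∘ₗ LinearMap.proj t ∘ₗ LinearMap.fst ℂ _ _ ∘ₗ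
      LinearMap.snd ℂ _ _ ∘ₗ e.toLinearMap
  u'_u := by
    rintro ⟨a, s | s⟩ ⟨b, t | t⟩
    · rcases eq_or_ne s t with rfl | h <;> simp [F.u'_u, *]
    · simp
    · simp
    · rcases eq_or_ne s t with rfl | h <;> simp [F.w'_w, eq_comm, *]
  w'_w := by
    rintro ⟨a, s | s⟩ ⟨b, t | t⟩
    · rcases eq_or_ne s t with rfl | h <;> simp [F.w'_w, *]
    · simp
    · simp
    · rcases eq_or_ne s t with rfl | h <;> simp [F.u'_u, eq_comm, *]
  u'_w := by
    rintro ⟨a, s | s⟩ ⟨b, t | t⟩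
    · rcases eq_or_ne s t with rfl | h <;> simp [F.u'_w, *]
    · simp
    · simp
    · rcases eq_or_ne s t with rfl | h <;> simp [F.u'_w, *]
  w'_u := by
    rintro ⟨a, s | s⟩ ⟨b, t | t⟩
    · rcases eq_or_ne s t with rfl | h <;> simp [F.w'_u, *]
    · simp
    · simp
    · rcases eq_or_ne s t with rfl | h <;> simp [F.w'_u, *]

theorem Frame.sum_signatureSum_unit [DecidableEq ι] (F : Frame ι V) {l r z : ℕ}
    (e : V' ≃ₗ[ℂ] (Fin l → V) × (Fin r → Module.Dual ℂ V) × (Fin z → ℂ)) (a b : ι) (v : V') :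
    e ((∑ s, (F.signatureSum e).unit (a, s) (b, s)) v) =
      (fun i => F.unit a b ((e v).1 i), fun i => -((e v).2.1 i ∘ₗ F.unit a b), 0) := by
  rw [Fintype.sum_sum_type, LinearMap.add_apply, LinearMap.sum_apply, LinearMap.sum_apply]
  simp only [Frame.unit_apply, Frame.signatureSum, map_add, map_sum, map_sub, map_smul,
    Sum.elim_inl, Sum.elim_inr, LinearEquiv.apply_symm_apply]
  refine Prod.ext ?_ (Prod.ext ?_ ?_)
  · funext i
    simp [Prod.fst_sum, Finset.sum_apply, Pi.single_apply]
  · funext i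
    ext x
    simp [Prod.fst_sum, Prod.snd_sum, Finset.sum_apply, Pi.single_apply, Frame.unit_apply,
      mul_comm]
  · simp [Prod.snd_sum]

theorem sum_sum_ite_smul {κ M : Type*} [AddCommGroup M] [Module ℂ M] [DecidableEq ι] [Fintype ι]
    [DecidableEq κ] [Fintype κ] (a b : ι) (f : ι × κ → ι × κ → M) :
    ∑ p, ∑ q, (if p.1 = a ∧ q = (b, p.2) then (1 : ℂ) else 0) • f p q = ∑ s, f (a, s) (b, s) := by
  simp only [ite_smul, one_smul, zero_smul, ite_and]
  rw [Fintype.sum_prod_type, Finset.sum_eq_single a]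
  · simp
  · intro c _ hc
    simp [hc]
  · simp

/-- The grading element of the induced frame is the image of `∑ a, y a a`, hence lies in `L'`. That
is all `IsNaturalRep.exists_hypUnits` needs to move the frame into `L'`, and it leaves the images of
the `y a b` fixed. -/
theorem HypUnits.exists_lift [DecidableEq ι] [Fintype ι] [FiniteDimensional ℂ V']
    {ρ : L →ₗ⁅ℂ⁆ Module.End ℂ V} {ρ' : L' →ₗ⁅ℂ⁆ Module.End ℂ V'} {j : L →ₗ⁅ℂ⁆ L'}
    (hρ' : IsNaturalRep ρ') {l r z : ℕ} (hsig : HasSignature ρ (ρ'.comp j) l r z)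
    {y : ι → ι → L} (hy : HypUnits ρ y) :
    ∃ y' : ι × (Fin l ⊕ Fin r) → ι × (Fin l ⊕ Fin r) → L', HypUnits ρ' y' ∧
      ∀ a b, j (y a b) = ∑ s, y' (a, s) (b, s) := by
  obtain ⟨F, hF⟩ := hy
  obtain ⟨e, he⟩ := hsig
  have key : ∀ a b, ρ' (j (y a b)) = ∑ s, (F.signatureSum e).unit (a, s) (b, s) := by
    intro a b
    refine LinearMap.ext fun v => e.injective ?_
    rw [F.sum_signatureSum_unit, ← hF]
    exact he _ v
  obtain ⟨y', hy', h⟩ := hρ'.exists_hypUnits (F.signatureSum e)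
    ⟨j (∑ a, y a a), by simp [Frame.grading, key, Fintype.sum_prod_type]⟩
  refine ⟨y', hy', fun a b => ?_⟩
  rw [h (fun p q => if p.1 = a ∧ q = (b, p.2) then 1 else 0) (j (y a b))
    (by rw [key, Frame.comb, sum_sum_ite_smul]), sum_sum_ite_smul]

end Lift

/-! ### Adding one index to a system of matrix units -/

section Extend

variable {ι L V : Type*} [LieRing L] [LieAlgebra ℂ L] [AddCommGroup V] [Module ℂ V]

/-- The frame obtained by adding a pair of vectors and a biorthogonal pair of functionals. -/
def Frame.extend [DecidableEq ι] (F : Frame ι V) (e f : V) (e' f' : Module.Dual ℂ V)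
    (he : ∀ a, F.u' a e = 0 ∧ F.w' a e = 0) (hf : ∀ a, F.u' a f = 0 ∧ F.w' a f = 0)
    (he' : ∀ a, e' (F.u a) = 0 ∧ e' (F.w a) = 0) (hf' : ∀ a, f' (F.u a) = 0 ∧ f' (F.w a) = 0)
    (h : (e' e = 1 ∧ e' f = 0) ∧ f' f = 1 ∧ f' e = 0) : Frame (Option ι) V where
  u o := o.elim e F.u
  w o := o.elim f F.w
  u' o := o.elim e' F.u'
  w' o := o.elim f' F.w'
  u'_u := by rintro (_ | a) (_ | b) <;> simp [he, he', h, F.u'_u]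
  w'_w := by rintro (_ | a) (_ | b) <;> simp [hf, hf', h, F.w'_w]
  u'_w := by rintro (_ | a) (_ | b) <;> simp [hf, he', h, F.u'_w]
  w'_u := by rintro (_ | a) (_ | b) <;> simp [he, hf', h, F.w'_u]

/-- The common kernel of the functionals of a frame. -/
def Frame.ker [DecidableEq ι] (F : Frame ι V) : Submodule ℂ V :=
  LinearMap.ker ((LinearMap.pi F.u').prod (LinearMap.pi F.w'))

theorem Frame.mem_ker [DecidableEq ι] (F : Frame ι V) {v : V} :
    v ∈ F.ker ↔ ∀ a, F.u' a v = 0 ∧ F.w' a v = 0 := by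
  simp [Frame.ker, funext_iff, forall_and]

theorem Frame.le_finrank_ker [DecidableEq ι] [Fintype ι] [FiniteDimensional ℂ V]
    (F : Frame ι V) : Module.finrank ℂ V ≤ 2 * Fintype.card ι + Module.finrank ℂ F.ker := by
  have h := LinearMap.finrank_range_add_finrank_ker
    ((LinearMap.pi F.u').prod (LinearMap.pi F.w'))
  have h2 := Submodule.finrank_le
    (LinearMap.range ((LinearMap.pi F.u').prod (LinearMap.pi F.w')))
  rw [Module.finrank_prod, Module.finrank_fintype_fun_eq_card] at h2
  unfold Frame.ker
  omega

/-- The projection onto the common kernel along the span of the vectors of a frame. -/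
def Frame.proj [DecidableEq ι] [Fintype ι] (F : Frame ι V) : V →ₗ[ℂ] F.ker :=
  (LinearMap.id - ∑ a, (F.u' a).smulRight (F.u a) - ∑ a, (F.w' a).smulRight (F.w a)).codRestrict
    F.ker fun v => F.mem_ker.2 fun a => by
      simp [LinearMap.sum_apply, F.u'_u, F.w'_w, F.u'_w, F.w'_u]

theorem Frame.coe_proj [DecidableEq ι] [Fintype ι] (F : Frame ι V) (v : V) :
    (F.proj v : V) = v - ∑ a, F.u' a v • F.u a - ∑ a, F.w' a v • F.w a := by
  simp [Frame.proj, LinearMap.sum_apply]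

theorem Frame.proj_u [DecidableEq ι] [Fintype ι] (F : Frame ι V) (a : ι) :
    F.proj (F.u a) = 0 := by
  ext
  simp [F.coe_proj, F.u'_u, F.w'_u]

theorem Frame.proj_w [DecidableEq ι] [Fintype ι] (F : Frame ι V) (a : ι) :
    F.proj (F.w a) = 0 := by
  ext
  simp [F.coe_proj, F.u'_w, F.w'_w]

theorem Frame.proj_coe [DecidableEq ι] [Fintype ι] (F : Frame ι V) (v : F.ker) :
    F.proj v = v := by
  ext
  rw [F.coe_proj]
  simp [F.mem_ker.1 v.2]

theorem Frame.exists_extend [DecidableEq ι] [Fintype ι] [FiniteDimensional ℂ V]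
    (F : Frame ι V) (h : 2 ≤ Module.finrank ℂ F.ker) :
    ∃ G : Frame (Option ι) V, ∀ a b, G.unit (some a) (some b) = F.unit a b := by
  let B := Module.finBasis ℂ F.ker
  let i : Fin (Module.finrank ℂ F.ker) := ⟨0, by omega⟩
  let j : Fin (Module.finrank ℂ F.ker) := ⟨1, by omega⟩
  have hij : i ≠ j := by simp [i, j]
  exact ⟨F.extend (B i) (B j) (B.coord i ∘ₗ F.proj) (B.coord j ∘ₗ F.proj)
    (F.mem_ker.1 (B i).2) (F.mem_ker.1 (B j).2) (fun a => by simp [F.proj_u, F.proj_w])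
    (fun a => by simp [F.proj_u, F.proj_w]) (by simp [F.proj_coe, hij, hij.symm]),
    fun a b => rfl⟩

/-- A quadratic form on a space of dimension at least two has a nonzero isotropic vector. -/
theorem exists_isotropic (B : LinearMap.BilinForm ℂ V) (h : 2 ≤ Module.finrank ℂ V) :
    ∃ e, e ≠ 0 ∧ B e e = 0 := by
  have : FiniteDimensional ℂ V := Module.finite_of_finrank_pos (by omega)
  let b := Module.finBasis ℂ V
  let i : Fin (Module.finrank ℂ V) := ⟨0, by omega⟩
  let j : Fin (Module.finrank ℂ V) := ⟨1, by omega⟩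
  have hij : i ≠ j := by simp [i, j]
  by_cases h0 : B (b j) (b j) = 0
  · exact ⟨b j, b.ne_zero j, h0⟩
  -- The form at `b i + t • b j` is a quadratic polynomial in `t`, whose discriminant is a square
  -- over `ℂ`.
  · obtain ⟨s, hs⟩ := IsAlgClosed.exists_pow_nat_eq
      (discrim (B (b j) (b j)) (B (b i) (b j) + B (b j) (b i)) (B (b i) (b i))) two_pos
    obtain ⟨t, ht⟩ := exists_quadratic_eq_zero h0 ⟨s, by rw [← hs, sq]⟩
    refine ⟨b i + t • b j, fun h1 => ?_, ?_⟩
    · have := congrArg (b.coord i) h1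
      simp [hij.symm] at this
    · simp only [map_add, map_smul, LinearMap.add_apply, LinearMap.smul_apply, smul_eq_mul]
      linear_combination ht

/-- For a hyperbolic frame, `F.ker` is the orthogonal complement of the frame vectors, so the form
is nondegenerate on it and a hyperbolic plane splits off. -/
theorem Frame.IsHyperbolic.exists_extend [DecidableEq ι] [Fintype ι] [FiniteDimensional ℂ V]
    {F : Frame ι V} {B : LinearMap.BilinForm ℂ V} (hF : F.IsHyperbolic B) (hB : B.Nondegenerate)
    (hs : B.IsSymm ∨ B.IsAlt) (h : 2 ≤ Module.finrank ℂ F.ker) :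
    ∃ G : Frame (Option ι) V, G.IsHyperbolic B ∧
      ∀ a b, G.unit (some a) (some b) = F.unit a b := by
  obtain ⟨ε, -, hsw⟩ := bilin_comm_smul hs
  obtain ⟨e, he, hee⟩ := exists_isotropic (B.restrict F.ker) h
  replace hee : B e e = 0 := hee
  have heu : ∀ x : F.ker, ∀ a, B x (F.u a) = 0 ∧ B x (F.w a) = 0 := by
    intro x a
    have := F.mem_ker.1 x.2 a
    rw [hF.1, hF.2] at this
    exact ⟨by rw [hsw, this.2, mul_zero], this.1⟩
  have heu' : ∀ x : F.ker, ∀ a, B (F.u a) x = 0 ∧ B (F.w a) x = 0 := by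
    intro x a
    rw [hsw, hsw (F.w a), (heu x a).1, (heu x a).2]
    simp
  obtain ⟨f, hf⟩ : ∃ f : F.ker, B e f ≠ 0 := by
    by_contra! hcon
    refine he (Subtype.ext (hB.1 _ fun v => ?_))
    have := hcon (F.proj v)
    rw [F.coe_proj] at this
    simpa [heu] using this
  let g : F.ker := (B e f)⁻¹ • f
  have hg : B e g = 1 := by simp [g, hf]
  -- In the symmetric case this correction makes the partner of `e` isotropic; in the alternating
  -- case it is isotropic anyway.
  let k : F.ker := g - (B g g / 2) • e
  have hk : B e k = 1 := by simp [k, hg, hee]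
  have hkk : B k k = 0 := by
    rcases hs with hs | hs
    · have : B g e = 1 := by rw [hs.eq, hg]
      simp only [k, Submodule.coe_sub, Submodule.coe_smul, map_sub, map_smul, LinearMap.sub_apply,
        LinearMap.smul_apply, smul_eq_mul, hg, hee, this]
      ring
    · exact hs _
  refine ⟨F.extend e k (B.flip k) (B e) (F.mem_ker.1 e.2) (F.mem_ker.1 k.2)
    (fun a => heu' k a) (fun a => heu e a) (by simp [hk, hkk, hee]), ⟨?_, ?_⟩, fun a b => rfl⟩
  · rintro (_ | a) v
    · rfl
    · exact hF.1 a v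
  · rintro (_ | a) v
    · rfl
    · exact hF.2 a v

/-- A frame uses two dimensions per index, so the bound leaves a kernel of dimension at least two.
When there is a form, the frame is first made hyperbolic; all its units are in the algebra already,
so none of them changes. -/
theorem HypUnits.exists_extend [DecidableEq ι] [Fintype ι] [FiniteDimensional ℂ V]
    {ρ : L →ₗ⁅ℂ⁆ Module.End ℂ V} (hρ : IsNaturalRep ρ) {y : ι → ι → L} (hy : HypUnits ρ y)
    (h : 2 * Fintype.card ι + 2 ≤ Module.finrank ℂ V) :
    ∃ y' : Option ι → Option ι → L, HypUnits ρ y' ∧ ∀ a b, y' (some a) (some b) = y a b := by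
  obtain ⟨F, hF⟩ := hy
  obtain ⟨hinj, hρ⟩ := hρ
  suffices H : ∃ G : Frame (Option ι) V, (∀ a b, G.unit a b ∈ ρ.range) ∧
      ∀ a b, G.unit (some a) (some b) = F.unit a b by
    obtain ⟨G, hG, hGF⟩ := H
    choose y' hy' using hG
    exact ⟨y', ⟨G, hy'⟩, fun a b => hinj (by rw [hF, ← hGF, ← hy']; rfl)⟩
  rcases hρ with hρ | ⟨B, hB, hs, hρ⟩
  · have := F.le_finrank_ker
    obtain ⟨G, hG⟩ := F.exists_extend (by omega)
    exact ⟨G, fun a b => (hρ _).2 (G.trace_unit a b), hG⟩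
  · have hmem : ∀ a b, F.unit a b ∈ skewAdjointLieSubalgebra B := fun a b => by
      rw [← hρ, ← hF]
      exact ⟨_, rfl⟩
    obtain ⟨G, hG, hc⟩ := F.exists_isHyperbolic hB hs (sum_mem fun a _ => hmem a a)
    have hunit : ∀ a b, G.unit a b = F.unit a b := by
      intro a b
      have := hc (fun i j => if i = a ∧ j = b then 1 else 0)
      simp only [Frame.comb, ite_smul, one_smul, zero_smul, ite_and, Finset.sum_ite_eq',
        Finset.mem_univ, if_true, Finset.sum_ite_irrel, Finset.sum_const_zero] at this
      exact (this (hmem a b)).symm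
    have := G.le_finrank_ker
    obtain ⟨G', hG', hGG'⟩ := hG.exists_extend hB hs (by omega)
    rw [hρ]
    exact ⟨G', hG'.unit_mem hs, fun a b => by rw [hGG', hunit]⟩

end Extend

/-! ### Matrix units along a diagonal chain -/

section Chain

variable {ι κ L : Type*} [LieRing L] [LieAlgebra ℂ L]

theorem IsGlUnits.map [DecidableEq ι] {L' : Type*} [LieRing L'] [LieAlgebra ℂ L'] {z : ι → ι → L}
    (hz : IsGlUnits z) {f : L →ₗ⁅ℂ⁆ L'} (hf : Function.Injective f) :
    IsGlUnits fun a b => f (z a b) where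
  lie a b c d := by
    rw [← LieHom.map_lie, hz.lie, map_sub]
    congr 1 <;> split_ifs <;> simp
  linearIndependent := hz.linearIndependent.map' (f : L →ₗ[ℂ] L') (LinearMap.ker_eq_bot.2 hf)

/-- A chain of classical subalgebras with natural modules, in which each inclusion is diagonal
with the natural module or its dual occurring `K i` times, and with `K i` positive. -/
structure IsDiagonalChain (S : ℕ → LieSubalgebra ℂ L) (d : ℕ → ℕ)
    (ρ : ∀ i, S i →ₗ⁅ℂ⁆ Module.End ℂ (Fin (d i) → ℂ)) (K : ℕ → ℕ) : Prop where
  le : ∀ i, S i ≤ S (i + 1)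
  natural : ∀ i, IsNaturalRep (ρ i)
  signature : ∀ i, ∃ l r z : ℕ, K i = l + r ∧
    HasSignature (ρ i) ((ρ (i + 1)).comp (LieSubalgebra.inclusion (le i))) l r z
  pos : ∀ i, 0 < K i
  unbounded : ∀ N i, ∃ j ≥ i, N ≤ d j

/-- Were the `d j` less than `N` from `i` on, the dimensions of the `S j` would be bounded by `N *
N`; a term of maximal dimension would then be all of `L`. -/
theorem exists_le_of_not_finiteDimensional {S : ℕ → LieSubalgebra ℂ L}
    (hS : ∀ i, S i ≤ S (i + 1)) {d : ℕ → ℕ}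
    {ρ : ∀ i, S i →ₗ⁅ℂ⁆ Module.End ℂ (Fin (d i) → ℂ)} (hcov : ∀ x : L, ∃ i, x ∈ S i)
    (hρ : ∀ i, Function.Injective (ρ i)) (hL : ¬ FiniteDimensional ℂ L) (N i : ℕ) :
    ∃ j ≥ i, N ≤ d j := by
  by_contra! hcon
  have hmono : Monotone S := monotone_nat_of_le_succ hS
  have hfin : ∀ j, Module.Finite ℂ (S j) := fun j =>
    Module.Finite.of_injective (ρ j : S j →ₗ[ℂ] Module.End ℂ (Fin (d j) → ℂ)) (hρ j)
  have hrank : ∀ j ≥ i, Module.finrank ℂ (S j) < N * N + 1 := by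
    intro j hj
    have h1 := LinearMap.finrank_le_finrank_of_injective
      (f := (ρ j : S j →ₗ[ℂ] Module.End ℂ (Fin (d j) → ℂ))) (hρ j)
    rw [Module.finrank_linearMap, Module.finrank_fin_fun] at h1
    have h2 := Nat.mul_le_mul (hcon j hj).le (hcon j hj).le
    omega
  obtain ⟨j, ⟨hj, hjmax⟩⟩ : ∃ j, j ≥ i ∧ ∀ k ≥ i,
      Module.finrank ℂ (S k) ≤ Module.finrank ℂ (S j) := by
    have hne : (Set.range fun k : {k // k ≥ i} => Module.finrank ℂ (S k.1)).Nonempty :=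
      ⟨_, ⟨⟨i, le_rfl⟩, rfl⟩⟩
    have hbdd : BddAbove (Set.range fun k : {k // k ≥ i} => Module.finrank ℂ (S k.1)) :=
      ⟨N * N + 1, by rintro _ ⟨k, rfl⟩; exact (hrank k.1 k.2).le⟩
    obtain ⟨k, hk⟩ := Nat.sSup_mem hne hbdd
    exact ⟨k.1, k.2, fun k' hk' => (le_csSup hbdd ⟨⟨k', hk'⟩, rfl⟩).trans hk.ge⟩
  have htop : (S j).toSubmodule = ⊤ := by
    refine eq_top_iff.2 fun x _ => ?_
    obtain ⟨k, hk⟩ := hcov x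
    have hle : (S j).toSubmodule ≤ (S (max j k)).toSubmodule := hmono (le_max_left j k)
    have hfin' : Module.Finite ℂ (S (max j k)).toSubmodule := hfin (max j k)
    rw [Submodule.eq_of_le_of_finrank_le hle (hjmax _ (hj.trans (le_max_left j k)))]
    exact hmono (le_max_right j k) hk
  have hfin' : Module.Finite ℂ (S j).toSubmodule := hfin j
  rw [htop] at hfin'
  exact hL (Module.finite_def.2 (Module.Finite.iff_fg.1 hfin'))

theorem IsDiagonal.exists_isDiagonalChain (h : IsDiagonal L) (hL : ¬ FiniteDimensional ℂ L) :
    ∃ S d ρ K, IsDiagonalChain (L := L) S d ρ K := by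
  obtain ⟨S, hS, d, ρ, hcov, hsimple, hnat, hsig⟩ := h
  choose l r z hsig using hsig
  refine ⟨S, d, ρ, fun i => l i + r i, hS, hnat, fun i => ⟨l i, r i, z i, rfl, hsig i⟩,
    fun i => ?_, exists_le_of_not_finiteDimensional hS hcov (fun i => (hnat i).1) hL⟩
  -- With no copy of the natural module or its dual, `S i` acts by zero on a faithful module, so it
  -- vanishes, contrary to simplicity.
  by_contra hcon
  obtain ⟨e, he⟩ := hsig i
  have hl : IsEmpty (Fin (l i)) := by
    have : l i = 0 := by omega
    rw [this]; infer_instance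
  have hr : IsEmpty (Fin (r i)) := by
    have : r i = 0 := by omega
    rw [this]; infer_instance
  have h0 : ∀ x : S i, x = 0 := by
    intro x
    apply LieSubalgebra.inclusion_injective (hS i)
    apply (hnat (i + 1)).1
    rw [map_zero, map_zero]
    refine LinearMap.ext fun v => e.injective ?_
    rw [LinearMap.zero_apply, map_zero]
    refine (he x v).trans ?_
    exact Prod.ext (Subsingleton.elim _ _) (Prod.ext (Subsingleton.elim _ _) rfl)
  exact (hsimple i).non_abelian ⟨fun x y => h0 _⟩

/-- The elements `z a b` of `L` lie in `S i` and act on its natural module as the matrix units of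
a frame. -/
def Stage {S : ℕ → LieSubalgebra ℂ L} {d : ℕ → ℕ}
    (ρ : ∀ i, S i →ₗ⁅ℂ⁆ Module.End ℂ (Fin (d i) → ℂ)) (i : ℕ) [DecidableEq ι]
    (z : ι → ι → L) : Prop :=
  ∃ y : ι → ι → S i, HypUnits (ρ i) y ∧ ∀ a b, (y a b : L) = z a b

variable {S : ℕ → LieSubalgebra ℂ L} {d : ℕ → ℕ}
  {ρ : ∀ i, S i →ₗ⁅ℂ⁆ Module.End ℂ (Fin (d i) → ℂ)} {K : ℕ → ℕ}

theorem Stage.isGlUnits [DecidableEq ι] (hρ : IsDiagonalChain S d ρ K) {i : ℕ} {z : ι → ι → L}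
    (hz : Stage ρ i z) : IsGlUnits z := by
  obtain ⟨y, hy, h⟩ := hz
  have : z = fun a b => (S i).incl (y a b) := funext fun a => funext fun b => (h a b).symm
  rw [this]
  exact (hy.isGlUnits (hρ.natural i).1).map Subtype.val_injective

theorem Stage.comp_injective [DecidableEq ι] [DecidableEq κ] {i : ℕ} {z : ι → ι → L}
    (hz : Stage ρ i z) {f : κ → ι} (hf : Function.Injective f) :
    Stage ρ i fun a b => z (f a) (f b) := by
  obtain ⟨y, hy, h⟩ := hz
  exact ⟨fun a b => y (f a) (f b), hy.comp_injective hf, fun a b => h _ _⟩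

theorem Stage.succ [DecidableEq ι] [Fintype ι] (hρ : IsDiagonalChain S d ρ K) {i : ℕ}
    {z : ι → ι → L} (hz : Stage ρ i z) :
    ∃ z' : ι × Fin (K i) → ι × Fin (K i) → L, Stage ρ (i + 1) z' ∧
      ∀ a b, z a b = ∑ s, z' (a, s) (b, s) := by
  obtain ⟨y, hy, h⟩ := hz
  obtain ⟨l, r, t, hK, hsig⟩ := hρ.signature i
  obtain ⟨y', hy', h'⟩ := hy.exists_lift (hρ.natural (i + 1)) hsig
  let σ : Fin (K i) ≃ Fin l ⊕ Fin r := (finCongr hK).trans finSumFinEquiv.symm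
  refine ⟨fun p q => (y' (p.1, σ p.2) (q.1, σ q.2) : L),
    ⟨_, hy'.comp_injective (f := fun p : ι × Fin (K i) => (p.1, σ p.2)) ?_, fun a b => rfl⟩,
    fun a b => ?_⟩
  · intro p q hpq
    simp only [Prod.mk.injEq, EmbeddingLike.apply_eq_iff_eq] at hpq
    exact Prod.ext hpq.1 hpq.2
  · rw [← h, ← LieSubalgebra.coe_inclusion (hρ.le i) (y a b), h' a b]
    rw [← σ.sum_comp]
    exact map_sum (S (i + 1)).toSubmodule.subtype _ _

theorem Stage.add [DecidableEq ι] [Fintype ι] (hρ : IsDiagonalChain S d ρ K) {i : ℕ}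
    {z : ι → ι → L} (hz : Stage ρ i z) (n : ℕ) {k : ℕ}
    (hk : ∏ t ∈ Finset.range n, K (i + t) = k) :
    ∃ z' : ι × Fin k → ι × Fin k → L,
      Stage ρ (i + n) z' ∧ ∀ a b, z a b = ∑ s, z' (a, s) (b, s) := by
  subst hk
  induction n with
  | zero =>
    rw [Finset.prod_range_zero]
    exact ⟨fun p q => z p.1 q.1, hz.comp_injective (f := Prod.fst)
      fun p q h => Prod.ext h (Subsingleton.elim _ _), fun a b => by simp⟩
  | succ n ih =>
    obtain ⟨z₁, hz₁, h₁⟩ := ih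
    obtain ⟨z₂, hz₂, h₂⟩ := hz₁.succ hρ
    let σ : Fin (∏ t ∈ Finset.range (n + 1), K (i + t)) ≃
        Fin (∏ t ∈ Finset.range n, K (i + t)) × Fin (K (i + n)) :=
      (finCongr (Finset.prod_range_succ _ _)).trans finProdFinEquiv.symm
    refine ⟨_, hz₂.comp_injective
      (f := fun p => ((p.1, (σ p.2).1), (σ p.2).2)) ?_, fun a b => ?_⟩
    · intro p q hpq
      simp only [Prod.mk.injEq] at hpq
      exact Prod.ext hpq.1.1 (σ.injective (Prod.ext hpq.1.2 hpq.2))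
    · rw [h₁, σ.sum_comp (fun s => z₂ ((a, s.1), s.2) ((b, s.1), s.2)), Fintype.sum_prod_type]
      exact Finset.sum_congr rfl fun s _ => h₂ _ _

theorem Stage.extend [DecidableEq ι] [Fintype ι] (hρ : IsDiagonalChain S d ρ K) {i : ℕ}
    {z : ι → ι → L} (hz : Stage ρ i z) (h : 2 * Fintype.card ι + 2 ≤ d i) :
    ∃ z' : Option ι → Option ι → L, Stage ρ i z' ∧ ∀ a b, z' (some a) (some b) = z a b := by
  obtain ⟨y, hy, hz⟩ := hz
  obtain ⟨y', hy', h'⟩ := hy.exists_extend (hρ.natural i) (by simpa using h)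
  exact ⟨fun a b => y' a b, ⟨y', hy', fun a b => rfl⟩, fun a b => by simp only [h', hz]⟩

theorem stage_of_isEmpty [DecidableEq ι] [IsEmpty ι] (i : ℕ) (z : ι → ι → L) : Stage ρ i z :=
  ⟨isEmptyElim, ⟨⟨isEmptyElim, isEmptyElim, isEmptyElim, isEmptyElim, isEmptyElim, isEmptyElim,
    isEmptyElim, isEmptyElim⟩, isEmptyElim⟩, isEmptyElim⟩

theorem exists_seq_of_step {α : Type*} (P : ℕ → α → Prop) (R : ℕ → α → α → Prop)
    (h0 : ∃ x, P 0 x) (hs : ∀ n x, P n x → ∃ x', P (n + 1) x' ∧ R n x x') :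
    ∃ f : ℕ → α, ∀ n, P n (f n) ∧ R n (f n) (f (n + 1)) := by
  choose! g hg using hs
  obtain ⟨x, hx⟩ := h0
  let f : ℕ → α := fun n => Nat.rec x (fun n x => g n x) n
  have hf : ∀ n, P n (f n) := fun n => by
    induction n with
    | zero => exact hx
    | succ n ih => exact (hg n _ ih).1
  exact ⟨f, fun n => ⟨hf n, (hg n _ (hf n)).2⟩⟩

/-- The case of a chain in which the natural module eventually occurs only once. -/
theorem IsDiagonalChain.exists_isGlUnits_of_eventually_one (hρ : IsDiagonalChain S d ρ K)
    {i₀ : ℕ} (hK : ∀ i ≥ i₀, K i = 1) : ∃ z : ℕ → ℕ → L, IsGlUnits z := by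
  obtain ⟨f, hf⟩ := exists_seq_of_step (α := ℕ × (ℕ → ℕ → L))
    (fun n x => i₀ ≤ x.1 ∧ Stage ρ x.1 fun a b : Fin n => x.2 a b)
    (fun n x x' => ∀ a b, a < n → b < n → x'.2 a b = x.2 a b)
    ⟨(i₀, fun _ _ => 0), le_rfl, stage_of_isEmpty _ _⟩ (by
      rintro n ⟨i, z⟩ ⟨hi, hz⟩
      obtain ⟨j, hj, hd⟩ := hρ.unbounded (2 * n + 2) i
      obtain ⟨k, rfl⟩ := Nat.exists_eq_add_of_le hj
      -- All multiplicities passed are `1`, so the units remain the same elements of `L`, now in an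
      -- algebra with room for one more index.
      obtain ⟨z₁, hz₁, h₁⟩ := hz.add hρ k
        (Finset.prod_eq_one fun t _ => hK _ (by simp only at *; omega))
      obtain ⟨z₂, hz₂, h₂⟩ := (hz₁.comp_injective (f := fun a : Fin n => (a, 0))
        fun a b h => (Prod.mk.inj h).1).extend hρ (by simpa using hd)
      refine ⟨(i + k, fun a b => if h : a < n + 1 ∧ b < n + 1 then
        z₂ (finSuccEquivLast ⟨a, h.1⟩) (finSuccEquivLast ⟨b, h.2⟩) else 0),
        ⟨by simp only at *; omega, ?_⟩, ?_⟩
      · convert hz₂.comp_injective finSuccEquivLast.injective using 3 with a b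
        exact dif_pos ⟨a.2, b.2⟩
      · intro a b ha hb
        have e : ∀ c (hc : c < n), finSuccEquivLast ⟨c, hc.trans n.lt_succ_self⟩ =
            some (⟨c, hc⟩ : Fin n) := fun c hc => finSuccEquivLast_castSucc ⟨c, hc⟩
        have := h₁ ⟨a, ha⟩ ⟨b, hb⟩
        rw [Fin.sum_univ_one] at this
        simp only
        rw [dif_pos ⟨ha.trans n.lt_succ_self, hb.trans n.lt_succ_self⟩, e a ha, e b hb, h₂]
        exact this.symm)
  exact exists_isGlUnits_of_coherent (fun n => (f n).2)
    (fun n => (hf n).1.2.isGlUnits hρ) fun n => (hf n).2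

end Chain

/-! ### Integral solutions of the branching recurrence -/

section Moments

open Polynomial

/-- Integration of polynomials over the unit interval. -/
noncomputable def unitIntegral : ℝ[X] →ₗ[ℝ] ℝ where
  toFun p := ∫ x in (0 : ℝ)..1, p.eval x
  map_add' p q := by
    simp only [eval_add]
    exact intervalIntegral.integral_add (p.continuous.intervalIntegrable _ _)
      (q.continuous.intervalIntegrable _ _)
  map_smul' c p := by simp

theorem unitIntegral_pos {p : ℝ[X]} (hp : ∀ x ∈ Set.Icc (0 : ℝ) 1, 0 ≤ p.eval x)
    (h : ∃ x ∈ Set.Icc (0 : ℝ) 1, 0 < p.eval x) : 0 < unitIntegral p :=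
  intervalIntegral.integral_pos zero_lt_one p.continuous.continuousOn
    (fun x hx => hp x (Set.Ioc_subset_Icc_self hx)) h

theorem eq_zero_of_unitIntegral_mul_self {g : ℝ[X]} (h : unitIntegral (g * g) = 0) : g = 0 := by
  by_contra hg
  refine (unitIntegral_pos (p := g * g) (fun x _ => by simp [mul_self_nonneg]) ?_).ne' h
  by_contra! hcon
  refine hg (eq_zero_of_infinite_isRoot g ((Set.Icc_infinite zero_lt_one).mono fun x hx => ?_))
  have := hcon x hx
  rw [eval_mul] at this
  exact mul_self_eq_zero.1 (le_antisymm this (mul_self_nonneg _))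

theorem unitIntegral_mul_eq_zero {g : ℝ[X]} {n : ℕ} (h : ∀ i ≤ n, unitIntegral (X ^ i * g) = 0)
    {p : ℝ[X]} (hp : p.natDegree ≤ n) : unitIntegral (p * g) = 0 := by
  rw [p.as_sum_range_C_mul_X_pow' (n := n + 1) (by omega), Finset.sum_mul, map_sum]
  refine Finset.sum_eq_zero fun i hi => ?_
  rw [mul_assoc, ← smul_eq_C_mul, map_smul, h i (by simpa [Nat.lt_succ_iff] using hi), smul_zero]

theorem natDegree_X_pow_mul_one_sub_X_pow_le {R : Type*} [CommRing R] [Nontrivial R] (i j : ℕ) :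
    (X ^ i * (1 - X) ^ j : R[X]).natDegree ≤ i + j := by
  refine natDegree_mul_le.trans (add_le_add (natDegree_X_pow i).le ?_)
  exact (natDegree_pow_le_of_le j ((natDegree_sub_le _ _).trans (by simp) :
    (1 - X : R[X]).natDegree ≤ 1)).trans (mul_one j).le

/-- There is a polynomial all of whose moments up to order `n` vanish, and whose next moment
is `1`. -/
theorem exists_unitIntegral_moments (n : ℕ) : ∃ g : ℝ[X],
    (∀ i ≤ n, unitIntegral (X ^ i * g) = 0) ∧ unitIntegral (X ^ (n + 1) * g) = 1 := by
  -- `T` sends a polynomial of degree at most `n + 1` to its first `n + 2` moments. If these vanish,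
  -- the polynomial is orthogonal to itself; so `T` is injective, hence surjective.
  let T : (Fin (n + 2) → ℝ) →ₗ[ℝ] (Fin (n + 2) → ℝ) :=
    LinearMap.pi fun i => unitIntegral ∘ₗ LinearMap.mulLeft ℝ (X ^ (i : ℕ)) ∘ₗ
      (degreeLT ℝ (n + 2)).subtype ∘ₗ (degreeLTEquiv ℝ (n + 2)).symm.toLinearMap
  have hT : Function.Injective T := by
    refine (injective_iff_map_eq_zero T).2 fun v hv => ?_
    let g := (degreeLTEquiv ℝ (n + 2)).symm v
    have hg : (g : ℝ[X]) = 0 := by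
      apply eq_zero_of_unitIntegral_mul_self
      refine unitIntegral_mul_eq_zero (n := n + 1)
        (fun i hi => congrFun hv ⟨i, by omega⟩) ?_
      by_cases h0 : (g : ℝ[X]) = 0
      · simp [h0]
      · have h1 : (g : ℝ[X]).natDegree < n + 2 := (natDegree_lt_iff_degree_lt h0).2
          (mem_degreeLT.1 g.2)
        omega
    exact (degreeLTEquiv ℝ (n + 2)).symm.map_eq_zero_iff.1 (Subtype.ext hg)
  obtain ⟨v, hv⟩ := LinearMap.injective_iff_surjective.1 hT (Pi.single (Fin.last (n + 1)) 1)
  refine ⟨(degreeLTEquiv ℝ (n + 2)).symm v, fun i hi => ?_, ?_⟩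
  · have := congrFun hv ⟨i, by omega⟩
    rw [Pi.single_eq_of_ne (by simp [Fin.ext_iff]; omega)] at this
    exact this
  · have := congrFun hv (Fin.last (n + 1))
    rw [Pi.single_eq_same] at this
    exact this

/-- The numbers `m j`, for `j ≤ n`, are proportional to the integrals of
`x ^ j * (1 - x) ^ (n - j)` for a positive density on the unit interval, the moments of which
become integers up to order `n` after scaling. -/
def IsMomentSystem (n : ℕ) (m : ℕ → ℕ) : Prop :=
  ∃ (f : ℝ[X]) (D : ℕ), 0 < D ∧ (∀ x ∈ Set.Icc (0 : ℝ) 1, 0 < f.eval x) ∧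
    (∀ i ≤ n, ∃ c : ℤ, D * unitIntegral (X ^ i * f) = c) ∧
    ∀ j ≤ n, (m j : ℝ) = D * unitIntegral (X ^ j * (1 - X) ^ (n - j) * f)

theorem unitIntegral_bernstein_pos {f : ℝ[X]} (hf : ∀ x ∈ Set.Icc (0 : ℝ) 1, 0 < f.eval x)
    (i j : ℕ) : 0 < unitIntegral (X ^ i * (1 - X) ^ j * f) := by
  refine unitIntegral_pos (fun x hx => ?_) ⟨1 / 2, by constructor <;> norm_num, ?_⟩
  · have h0 : 0 ≤ 1 - x := by linarith [hx.2]
    have h1 := (hf x hx).le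
    have h2 := hx.1
    simp only [eval_mul, eval_pow, eval_X, eval_sub, eval_one]
    positivity
  · have h1 := hf (1 / 2) (by constructor <;> norm_num)
    simp only [eval_mul, eval_pow, eval_X, eval_sub, eval_one]
    refine mul_pos (mul_pos (by positivity) (pow_pos (by norm_num) _)) h1

theorem IsMomentSystem.pos {n : ℕ} {m : ℕ → ℕ} (h : IsMomentSystem n m) {j : ℕ} (hj : j ≤ n) :
    0 < m j := by
  obtain ⟨f, D, hD, hf, -, hm⟩ := h
  have : (0 : ℝ) < m j := by
    rw [hm j hj]
    exact mul_pos (by exact_mod_cast hD) (unitIntegral_bernstein_pos hf _ _)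
  exact_mod_cast this

theorem isMomentSystem_zero : IsMomentSystem 0 fun _ => 1 := by
  have h1 : unitIntegral 1 = 1 := by simp [unitIntegral]
  refine ⟨1, 1, one_pos, by simp, fun i hi => ⟨1, ?_⟩, fun j hj => ?_⟩
  · obtain rfl : i = 0 := by omega
    simp [h1]
  · obtain rfl : j = 0 := by omega
    simp [h1]

theorem exists_int_unitIntegral {f : ℝ[X]} {D : ℝ} {n : ℕ}
    (h : ∀ i ≤ n, ∃ c : ℤ, D * unitIntegral (X ^ i * f) = c) (p : ℤ[X]) (hp : p.natDegree ≤ n) :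
    ∃ c : ℤ, D * unitIntegral (p.map (Int.castRingHom ℝ) * f) = c := by
  choose! c hc using h
  refine ⟨∑ i ∈ Finset.range (n + 1), p.coeff i * c i, ?_⟩
  conv_lhs => rw [p.as_sum_range' (n + 1) (by omega)]
  simp only [Polynomial.map_sum, Finset.sum_mul, map_sum, Finset.mul_sum, Int.cast_sum]
  refine Finset.sum_congr rfl fun i hi => ?_
  rw [map_monomial, ← C_mul_X_pow_eq_monomial, mul_assoc, ← smul_eq_C_mul, map_smul, smul_eq_mul,
    Int.cast_mul, ← hc i (by simpa [Nat.lt_succ_iff] using hi)]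
  simp only [eq_intCast]
  ring

/-- The density becomes `f + η g` with `g` orthogonal to degrees up to `n`: the old moments, and
with them the recurrence, are kept, and `η` is free to adjust the moment of order `n + 1`. -/
theorem IsMomentSystem.exists_step {n : ℕ} {m : ℕ → ℕ} (h : IsMomentSystem n m) :
    ∃ k₀ : ℕ, ∀ k ≥ k₀, ∃ m', IsMomentSystem (n + 1) m' ∧
      ∀ j ≤ n, m' j + m' (j + 1) = k * m j := by
  obtain ⟨f, D, hD, hf, hint, hm⟩ := h
  obtain ⟨g, hg0, hg1⟩ := exists_unitIntegral_moments n
  obtain ⟨x₀, hx₀, hmin⟩ := isCompact_Icc.exists_isMinOn (Set.nonempty_Icc.2 zero_le_one)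
    (f.continuous.continuousOn (s := Set.Icc (0 : ℝ) 1))
  obtain ⟨M, hM⟩ := isCompact_Icc.exists_bound_of_continuousOn
    (g.continuous.continuousOn (s := Set.Icc (0 : ℝ) 1))
  have hM0 : 0 ≤ M := (norm_nonneg _).trans (hM x₀ hx₀)
  have hδ := hf x₀ hx₀
  obtain ⟨k₀, hk₀⟩ := exists_nat_gt (M / f.eval x₀)
  refine ⟨k₀ + 1, fun k hk => ?_⟩
  have hD' : (1 : ℝ) ≤ D := by exact_mod_cast hD
  have hk' : (k₀ : ℝ) + 1 ≤ k := by exact_mod_cast hk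
  have hk1 : (0 : ℝ) < k := by linarith [k₀.cast_nonneg (α := ℝ)]
  have hDk : (0 : ℝ) < (D * k : ℕ) := by push_cast; positivity
  let c := unitIntegral (X ^ (n + 1) * f)
  -- This rounds the new moment up to a multiple of `1 / (D * k)`. Since `η ≤ 1 / (D * k)`, a large
  -- `k` keeps the density positive.
  let η : ℝ := ⌈(D * k : ℕ) * c⌉ / (D * k : ℕ) - c
  have hη0 : 0 ≤ η := by
    rw [sub_nonneg, le_div_iff₀ hDk, mul_comm]
    exact Int.le_ceil _
  have hη1 : η * (D * k : ℕ) ≤ 1 := by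
    have := Int.ceil_lt_add_one (((D * k : ℕ) : ℝ) * c)
    rw [sub_mul, div_mul_cancel₀ _ hDk.ne']
    linarith
  have hηM : η * M < f.eval x₀ := by
    rw [div_lt_iff₀ hδ] at hk₀
    have h1 : M < f.eval x₀ * (D * k : ℕ) := by
      push_cast
      have : (k₀ : ℝ) ≤ D * k := by nlinarith
      nlinarith
    by_contra! hcon
    rcases hη0.eq_or_lt with h0 | h0
    · rw [← h0] at hcon
      linarith
    · nlinarith [mul_lt_mul_of_pos_left h1 h0]
  have hf' : ∀ x ∈ Set.Icc (0 : ℝ) 1, 0 < (f + C η * g).eval x := by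
    intro x hx
    have h1 : f.eval x₀ ≤ f.eval x := hmin hx
    have h2 := abs_le.1 (hM x hx)
    rw [eval_add, eval_mul, eval_C]
    nlinarith [h2.1]
  have hmom : ∀ p : ℝ[X], unitIntegral (p * (f + C η * g)) =
      unitIntegral (p * f) + η * unitIntegral (p * g) := by
    intro p
    rw [← smul_eq_C_mul, mul_add, mul_smul_comm, map_add, map_smul, smul_eq_mul]
  have hlow : ∀ i ≤ n, unitIntegral (X ^ i * (f + C η * g)) = unitIntegral (X ^ i * f) := by
    intro i hi
    rw [hmom, hg0 i hi, mul_zero, add_zero]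
  have hint' : ∀ i ≤ n + 1, ∃ c : ℤ,
      ((D * k : ℕ) : ℝ) * unitIntegral (X ^ i * (f + C η * g)) = c := by
    intro i hi
    rcases Nat.lt_or_eq_of_le hi with hi | rfl
    · obtain ⟨e, he⟩ := hint i (by omega)
      refine ⟨k * e, ?_⟩
      rw [hlow i (by omega)]
      push_cast
      rw [← he]
      ring
    · refine ⟨⌈(D * k : ℕ) * c⌉, ?_⟩
      rw [hmom, hg1, mul_one]
      change ((D * k : ℕ) : ℝ) * (c + (_ - c)) = _
      rw [add_sub_cancel, mul_div_cancel₀ _ hDk.ne']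
  have hm' : ∀ j ≤ n + 1, ∃ e : ℕ, (e : ℝ) = (D * k : ℕ) *
      unitIntegral (X ^ j * (1 - X) ^ (n + 1 - j) * (f + C η * g)) := by
    intro j hj
    obtain ⟨e, he⟩ := exists_int_unitIntegral hint' (X ^ j * (1 - X) ^ (n + 1 - j)) 
      ((natDegree_X_pow_mul_one_sub_X_pow_le _ _).trans (by omega))
    simp only [Polynomial.map_mul, Polynomial.map_pow, map_X, Polynomial.map_sub,
      Polynomial.map_one] at he
    have hpos : (0 : ℝ) < e := by
      rw [← he]
      exact mul_pos hDk (unitIntegral_bernstein_pos hf' _ _)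
    obtain ⟨e', rfl⟩ := Int.eq_ofNat_of_zero_le (Int.cast_pos.1 hpos).le
    exact ⟨e', by rw [he]; simp⟩
  choose! m' hm' using hm'
  refine ⟨m', ⟨f + C η * g, D * k, by exact_mod_cast hDk, hf', hint', hm'⟩, fun j hj => ?_⟩
  -- The recurrence is the identity `(1 - x) + x = 1`.
  have hsplit : (X ^ j * (1 - X) ^ (n + 1 - j) + X ^ (j + 1) * (1 - X) ^ (n + 1 - (j + 1)) : ℝ[X])
      = X ^ j * (1 - X) ^ (n - j) := by
    rw [Nat.succ_sub hj, Nat.add_sub_add_right, pow_succ, pow_succ]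
    ring
  have : (m' j : ℝ) + m' (j + 1) = k * m j := by
    rw [hm' j (by omega), hm' (j + 1) (by omega), hm j hj, ← mul_add, ← map_add, ← add_mul,
      hsplit, hmom, unitIntegral_mul_eq_zero hg0
        ((natDegree_X_pow_mul_one_sub_X_pow_le _ _).trans (by omega))]
    push_cast
    ring
  exact_mod_cast this

end Moments

/-! ### The exterior algebra by creation and annihilation operators -/

section Fock

/-- The sign with which the `a`-th basis vector passes to its place in a wedge product. -/
noncomputable def wedgeSign (a : ℕ) (B : Finset ℕ) : ℂ := (-1) ^ (B.filter (· < a)).card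

theorem wedgeSign_mul_self (a : ℕ) (B : Finset ℕ) : wedgeSign a B * wedgeSign a B = 1 := by
  rw [wedgeSign, ← mul_pow]
  simp

theorem wedgeSign_insert {a b : ℕ} {B : Finset ℕ} (hb : b ∉ B) :
    wedgeSign a (insert b B) = if b < a then -wedgeSign a B else wedgeSign a B := by
  unfold wedgeSign
  rw [Finset.filter_insert]
  split_ifs with h
  · rw [Finset.card_insert_of_notMem (by simp [hb]), pow_succ, mul_neg_one]
  · rfl

theorem wedgeSign_erase {a b : ℕ} {B : Finset ℕ} (hb : b ∈ B) :
    wedgeSign a (B.erase b) = if b < a then -wedgeSign a B else wedgeSign a B := by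
  conv_rhs => rw [← Finset.insert_erase hb]
  rw [wedgeSign_insert (Finset.notMem_erase b B)]
  split_ifs <;> simp

/-- Exterior multiplication by the `a`-th basis vector, in the basis of wedge products. -/
noncomputable def creation (a : ℕ) : Module.End ℂ (Finset ℕ →₀ ℂ) :=
  Finsupp.linearCombination ℂ fun B =>
    if a ∈ B then 0 else wedgeSign a B • Finsupp.single (insert a B) 1

/-- Contraction with the `a`-th coordinate functional, in the basis of wedge products. -/
noncomputable def annihilation (a : ℕ) : Module.End ℂ (Finset ℕ →₀ ℂ) :=
  Finsupp.linearCombination ℂ fun B =>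
    if a ∈ B then wedgeSign a B • Finsupp.single (B.erase a) 1 else 0

theorem creation_single (a : ℕ) (B : Finset ℕ) (c : ℂ) : creation a (Finsupp.single B c) =
    if a ∈ B then 0 else Finsupp.single (insert a B) (c * wedgeSign a B) := by
  rw [creation, Finsupp.linearCombination_single]
  split_ifs <;> simp

theorem annihilation_single (a : ℕ) (B : Finset ℕ) (c : ℂ) :
    annihilation a (Finsupp.single B c) =
      if a ∈ B then Finsupp.single (B.erase a) (c * wedgeSign a B) else 0 := by
  rw [annihilation, Finsupp.linearCombination_single]
  split_ifs <;> simp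

theorem creation_creation (a b : ℕ) (x : Finset ℕ →₀ ℂ) :
    creation a (creation b x) = -creation b (creation a x) := by
  induction x using Finsupp.induction_linear with
  | zero => simp
  | add x y hx hy => simp [hx, hy, add_comm]
  | single B c =>
    rcases lt_trichotomy a b with h | rfl | h
    · by_cases ha : a ∈ B <;> by_cases hb : b ∈ B <;>
      simp [*, -Finsupp.single_mul, creation_single, wedgeSign_insert, h.ne, h.ne', h.not_gt,
        Finset.insert_comm a b, mul_right_comm]
    · by_cases ha : a ∈ B <;> simp [*, -Finsupp.single_mul, creation_single]
    · by_cases ha : a ∈ B <;> by_cases hb : b ∈ B <;>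
      simp [*, -Finsupp.single_mul, creation_single, wedgeSign_insert, h.ne, h.ne', h.not_gt,
        Finset.insert_comm a b, mul_right_comm]

theorem annihilation_annihilation (a b : ℕ) (x : Finset ℕ →₀ ℂ) :
    annihilation a (annihilation b x) = -annihilation b (annihilation a x) := by
  induction x using Finsupp.induction_linear with
  | zero => simp
  | add x y hx hy => simp [hx, hy, add_comm]
  | single B c =>
    rcases lt_trichotomy a b with h | rfl | h
    · by_cases ha : a ∈ B <;> by_cases hb : b ∈ B <;>
      simp [*, -Finsupp.single_mul, annihilation_single, wedgeSign_erase, h.ne, h.ne', h.not_gt,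
        Finset.erase_right_comm (a := a) (b := b), mul_right_comm]
    · by_cases ha : a ∈ B <;> simp [*, -Finsupp.single_mul, annihilation_single]
    · by_cases ha : a ∈ B <;> by_cases hb : b ∈ B <;>
      simp [*, -Finsupp.single_mul, annihilation_single, wedgeSign_erase, h.ne, h.ne', h.not_gt,
        Finset.erase_right_comm (a := a) (b := b), mul_right_comm]

theorem annihilation_creation (a b : ℕ) (x : Finset ℕ →₀ ℂ) :
    annihilation a (creation b x) = (if a = b then x else 0) - creation b (annihilation a x) := by
  induction x using Finsupp.induction_linear with
  | zero => simp
  | add x y hx hy =>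
    simp only [map_add, hx, hy]
    split_ifs <;> abel
  | single B c =>
    rcases lt_trichotomy a b with h | rfl | h
    · by_cases ha : a ∈ B <;> by_cases hb : b ∈ B <;>
      simp [*, -Finsupp.single_mul, annihilation_single, creation_single, wedgeSign_erase,
        wedgeSign_insert, h.ne, h.ne', h.not_gt, Finset.erase_insert_of_ne, mul_right_comm]
    · by_cases ha : a ∈ B <;>
      simp [*, -Finsupp.single_mul, annihilation_single, creation_single, wedgeSign_erase,
        wedgeSign_insert, mul_assoc, wedgeSign_mul_self]
    · by_cases ha : a ∈ B <;> by_cases hb : b ∈ B <;>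
      simp [*, -Finsupp.single_mul, annihilation_single, creation_single, wedgeSign_erase,
        wedgeSign_insert, h.ne, h.ne', h.not_gt, Finset.erase_insert_of_ne, mul_right_comm]

/-- The action of the matrix unit `E a b` on the exterior algebra. -/
noncomputable def fockUnit (a b : ℕ) : Module.End ℂ (Finset ℕ →₀ ℂ) :=
  creation a * annihilation b

theorem fockUnit_apply (a b : ℕ) (x : Finset ℕ →₀ ℂ) :
    fockUnit a b x = creation a (annihilation b x) := rfl

/-- Only the anticommutation relations enter: moving annihilations past creations leaves two quartic
terms, which agree after one swap of each kind. -/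
theorem fockUnit_commutator (a b c d : ℕ) (x : Finset ℕ →₀ ℂ) :
    fockUnit a b (fockUnit c d x) - fockUnit c d (fockUnit a b x) =
      (if b = c then fockUnit a d x else 0) - (if d = a then fockUnit c b x else 0) := by
  simp only [fockUnit_apply, annihilation_creation, map_sub]
  rw [creation_creation a c, annihilation_annihilation b d]
  split_ifs <;> simp only [map_neg, map_zero] <;> abel

/-- The matrix entries of `fockUnit a b` in the basis of wedge products. -/
noncomputable def fockCoeff (a b : ℕ) (A B : Finset ℕ) : ℂ := fockUnit a b (Finsupp.single B 1) A

theorem fockCoeff_eq (a b : ℕ) (A B : Finset ℕ) : fockCoeff a b A B =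
    if b ∈ B ∧ a ∉ B.erase b ∧ A = insert a (B.erase b)
    then wedgeSign b B * wedgeSign a (B.erase b) else 0 := by
  rw [fockCoeff, fockUnit_apply, annihilation_single]
  by_cases hb : b ∈ B
  · rw [if_pos hb, creation_single]
    by_cases ha : a ∈ B.erase b
    · rw [if_pos ha]
      simp [ha]
    · rw [if_neg ha, Finsupp.single_apply]
      simp only [hb, ha, one_mul, true_and, not_false_eq_true, eq_comm]
  · simp [hb]

theorem card_eq_of_fockCoeff_ne_zero {a b : ℕ} {A B : Finset ℕ} (h : fockCoeff a b A B ≠ 0) :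
    A.card = B.card := by
  rw [fockCoeff_eq] at h
  obtain ⟨hb, ha, rfl⟩ := of_not_not fun h' => h (if_neg h')
  rw [Finset.card_insert_of_notMem ha, Finset.card_erase_add_one hb]

theorem subset_of_fockCoeff_ne_zero {a b n : ℕ} {A B : Finset ℕ} (h : fockCoeff a b A B ≠ 0)
    (ha : a < n) (hB : B ⊆ Finset.range n) : A ⊆ Finset.range n := by
  rw [fockCoeff_eq] at h
  obtain ⟨-, -, rfl⟩ := of_not_not fun h' => h (if_neg h')
  exact Finset.insert_subset (by simpa using ha) ((Finset.erase_subset _ _).trans hB)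

theorem fockCoeff_eq_zero_of_mem {a b n : ℕ} {A B : Finset ℕ} (ha : a < n) (hb : b < n)
    (h : ¬ (n ∈ A ↔ n ∈ B)) : fockCoeff a b A B = 0 := by
  rw [fockCoeff_eq, if_neg]
  rintro ⟨-, -, rfl⟩
  simp [ha.ne', hb.ne'] at h

/-- The index `n` lies above `a` and `b`, so it is never counted in their signs: wedging with the
last basis vector commutes with `gl(n)`. This and `fockCoeff_eq_zero_of_mem` are the branching rule
in matrix entries. -/
theorem fockCoeff_insert {a b n : ℕ} {A B : Finset ℕ} (ha : a < n) (hb : b < n)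
    (hA : n ∉ A) (hB : n ∉ B) :
    fockCoeff a b (insert n A) (insert n B) = fockCoeff a b A B := by
  have h1 : (insert n B).erase b = insert n (B.erase b) := Finset.erase_insert_of_ne hb.ne'
  have hn : n ∉ B.erase b := fun h => hB (Finset.mem_of_mem_erase h)
  rw [fockCoeff_eq, fockCoeff_eq, h1, wedgeSign_insert hB, wedgeSign_insert hn,
    if_neg hb.not_gt, if_neg ha.not_gt, Finset.insert_comm a n]
  have h2 : insert n A = insert n (insert a (B.erase b)) ↔ A = insert a (B.erase b) := by
    refine ⟨fun h => ?_, fun h => by rw [h]⟩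
    have := congrArg (fun C => C.erase n) h
    simpa [Finset.erase_insert, hA, hn, ha.ne'] using this
  simp only [h2, Finset.mem_insert, hb.ne, ha.ne, false_or]

theorem fockCoeff_singleton (a b c d : ℕ) :
    fockCoeff a b {c} {d} = if c = a ∧ d = b then 1 else 0 := by
  rw [fockCoeff_eq]
  by_cases h : d = b
  · subst h
    by_cases h' : c = a <;> simp [h', wedgeSign, Finset.filter_singleton]
  · simp [h, Ne.symm h]

theorem sum_fockCoeff_mul (a b : ℕ) {c n : ℕ} (d : ℕ) (A : Finset ℕ) {B : Finset ℕ} (hc : c < n)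
    (hB : B ⊆ Finset.range n) :
    ∑ C ∈ (Finset.range n).powerset, fockCoeff a b A C * fockCoeff c d C B =
      fockUnit a b (fockUnit c d (Finsupp.single B 1)) A := by
  have h : fockUnit c d (Finsupp.single B 1) =
      ∑ C ∈ (Finset.range n).powerset, fockCoeff c d C B • Finsupp.single C (1 : ℂ) := by
    ext C
    rw [Finsupp.finsetSum_apply]
    simp only [Finsupp.smul_apply, Finsupp.single_apply, smul_eq_mul, mul_ite, mul_one, mul_zero,
      Finset.sum_ite_eq']
    split_ifs with hC
    · rfl
    · by_contra hne
      exact hC (Finset.mem_powerset.2 (subset_of_fockCoeff_ne_zero hne hc hB))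
  rw [h, map_sum, Finsupp.finsetSum_apply]
  refine Finset.sum_congr rfl fun C _ => ?_
  rw [map_smul, Finsupp.smul_apply, smul_eq_mul, mul_comm]
  rfl

end Fock

/-! ### Sums of exterior powers and their branching -/

section FockModule

variable {L : Type*} [LieRing L] [LieAlgebra ℂ L]

/-- The basis of a sum of exterior powers of `ℂ ^ n`, the `j`-th one taken `m j` times. -/
def fockIndex (n : ℕ) (m : ℕ → ℕ) : Finset (Σ _ : Finset ℕ, ℕ) :=
  (Finset.range n).powerset.sigma fun A => Finset.range (m A.card)

theorem mem_fockIndex {n : ℕ} {m : ℕ → ℕ} {x : Σ _ : Finset ℕ, ℕ} :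
    x ∈ fockIndex n m ↔ x.1 ⊆ Finset.range n ∧ x.2 < m x.1.card := by
  simp [fockIndex]

/-- The matrix entries of the matrix unit `E a b` on sums of exterior powers. -/
noncomputable def multCoeff (a b : ℕ) (x y : Σ _ : Finset ℕ, ℕ) : ℂ :=
  if x.2 = y.2 then fockCoeff a b x.1 y.1 else 0

/-- The units preserve the cardinality of a subset, so they stay within a numbered copy of one
exterior power, and restricting to `fockIndex n m` loses no terms. -/
theorem sum_multCoeff_mul {n : ℕ} {m : ℕ → ℕ} (a b : ℕ) {c : ℕ} (d : ℕ) (hc : c < n)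
    (x y : fockIndex n m) :
    ∑ v : fockIndex n m, multCoeff a b x v * multCoeff c d v y =
      if x.1.2 = y.1.2 then fockUnit a b (fockUnit c d (Finsupp.single y.1.1 1)) x.1.1 else 0 := by
  have hy := mem_fockIndex.1 y.2
  rw [Finset.sum_coe_sort (fockIndex n m) (fun v => multCoeff a b x v * multCoeff c d v y),
    ← sum_fockCoeff_mul a b d _ hc hy.1]
  refine (Finset.sum_sigma _ _ _).trans ?_
  have h : ∀ C, ∑ r ∈ Finset.range (m C.card),
      multCoeff a b x ⟨C, r⟩ * multCoeff c d ⟨C, r⟩ y =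
      if x.1.2 = y.1.2 then fockCoeff a b x.1.1 C * fockCoeff c d C y.1.1 else 0 := by
    intro C
    by_cases h0 : fockCoeff c d C y.1.1 = 0
    · simp [multCoeff, h0]
    · have hcard := card_eq_of_fockCoeff_ne_zero h0
      rw [Finset.sum_eq_single y.1.2]
      · simp [multCoeff]
      · intro r _ hr
        simp [multCoeff, hr]
      · intro hr
        rw [hcard] at hr
        exact (hr (Finset.mem_range.2 hy.2)).elim
  simp only [h]
  split_ifs <;> simp

/-- The matrix units acting on a sum of exterior powers, expressed through the elements `z` which
correspond to the matrix units of the general linear Lie algebra of this sum. -/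
noncomputable def fockElement (n : ℕ) (m : ℕ → ℕ)
    (z : (Σ _ : Finset ℕ, ℕ) → (Σ _ : Finset ℕ, ℕ) → L) (a b : ℕ) : L :=
  blockSum (fun x y : fockIndex n m => z x y) Finset.univ fun x y => multCoeff a b x y

/-- The brackets hold because the exterior algebra is a module. Independence is read off on a copy
of `Λ¹`, the natural module; this is why `m 1` has to be positive unless `n = 0`. -/
theorem isGlUnits_fockElement {n : ℕ} {m : ℕ → ℕ}
    {z : (Σ _ : Finset ℕ, ℕ) → (Σ _ : Finset ℕ, ℕ) → L}
    (hz : IsGlUnits fun x y : fockIndex n m => z x y) (hm : 1 ≤ n → 0 < m 1) :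
    IsGlUnits fun a b : Fin n => fockElement n m z a b := by
  have hsingle : ∀ a : Fin n, (⟨{(a : ℕ)}, 0⟩ : Σ _ : Finset ℕ, ℕ) ∈ fockIndex n m := fun a =>
    mem_fockIndex.2 ⟨by simp, by simpa using hm (by have := a.2; omega)⟩
  constructor
  · intro a b c d
    have h : ⁅fockElement n m z a b, fockElement n m z c d⁆ =
        blockSum (fun x y : fockIndex n m => z x y) Finset.univ (fun x y =>
          (if b = c then (1 : ℂ) else 0) * multCoeff a d x y +
            (if d = a then (-1 : ℂ) else 0) * multCoeff c b x y) := by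
      rw [fockElement, fockElement, hz.lie_blockSum]
      congr 1
      funext x y
      rw [sum_multCoeff_mul _ _ _ c.2, sum_multCoeff_mul _ _ _ a.2]
      have hcomm := congrArg (fun f => f x.1.1)
        (fockUnit_commutator a b c d (Finsupp.single y.1.1 1))
      simp only [Finsupp.sub_apply] at hcomm
      unfold multCoeff
      split_ifs with h1 h2 h3 h3
      all_goals simp_all [Fin.ext_iff, fockCoeff, sub_eq_add_neg]
    rw [h, blockSum_add, blockSum_smul, blockSum_smul]
    simp only [fockElement, ite_smul, one_smul, zero_smul, neg_smul, sub_eq_add_neg]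
    congr 1
    split_ifs <;> simp
  · rw [linearIndependent_iff']
    intro s g hg p hp
    have h : blockSum (fun x y : fockIndex n m => z x y) Finset.univ
        (fun x y => ∑ q ∈ s, g q * multCoeff q.1 q.2 x y) = 0 := by
      rw [← hg]
      simp only [fockElement, blockSum, Finset.sum_smul, Finset.smul_sum, mul_smul]
      rw [Finset.sum_comm (s := s)]
      exact Finset.sum_congr rfl fun x _ => Finset.sum_comm
    have h1 := hz.blockSum_eq_zero h (Finset.mem_univ ⟨_, hsingle p.1⟩)
      (Finset.mem_univ ⟨_, hsingle p.2⟩)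
    simp only [multCoeff, if_true, fockCoeff_singleton] at h1
    rw [Finset.sum_eq_single p] at h1
    · simpa using h1
    · rintro q - hq
      rw [if_neg, mul_zero]
      rintro ⟨e1, e2⟩
      exact hq (Prod.ext (Fin.ext e1.symm) (Fin.ext e2.symm))
    · exact fun h => (h hp).elim

/-- The branching rule for sums of exterior powers, on the level of bases. -/
def branch (n k : ℕ) (m' : ℕ → ℕ) (p : (Σ _ : Finset ℕ, ℕ) × Fin k) : Σ _ : Finset ℕ, ℕ :=
  -- The `k * m j` copies of `Λ^j(ℂⁿ)` are numbered by `s * k + q`. The first `m' j` of them become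
  -- subsets without `n` in `Λ^j(ℂⁿ⁺¹)`, the other `m' (j + 1)` become subsets containing `n` in
  -- `Λ^(j+1)(ℂⁿ⁺¹)`.
  if p.1.2 * k + p.2 < m' p.1.1.card then ⟨p.1.1, p.1.2 * k + p.2⟩
  else ⟨insert n p.1.1, p.1.2 * k + p.2 - m' p.1.1.card⟩

theorem mul_add_inj {k s t : ℕ} {q r : Fin k} (h : s * k + q = t * k + r) : s = t ∧ q = r := by
  have hk : 0 < k := q.pos
  have h1 := congrArg (· / k) h
  have h2 := congrArg (· % k) h
  simp only [Nat.mod_eq_of_lt q.2, Nat.mod_eq_of_lt r.2, mul_comm _ k,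
    Nat.mul_add_div hk, Nat.div_eq_of_lt q.2, Nat.div_eq_of_lt r.2, add_zero,
    Nat.mul_add_mod] at h1 h2
  exact ⟨h1, Fin.ext h2⟩

theorem mul_add_lt {k s M : ℕ} (q : Fin k) (h : s < M) : s * k + q < k * M := by
  have h1 : (s + 1) * k ≤ M * k := Nat.mul_le_mul_right k h
  have h2 := q.2
  rw [add_mul, one_mul, mul_comm M] at h1
  omega

theorem notMem_of_subset_range {n : ℕ} {A : Finset ℕ} (h : A ⊆ Finset.range n) : n ∉ A :=
  fun h' => by simpa using h h'

section Branch

variable {n k : ℕ} {m m' : ℕ → ℕ}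

theorem card_le_of_subset_range {A : Finset ℕ} (h : A ⊆ Finset.range n) : A.card ≤ n := by
  simpa using Finset.card_le_card h

theorem branch_mem_fockIndex (hm : ∀ j ≤ n, m' j + m' (j + 1) = k * m j)
    {x : Σ _ : Finset ℕ, ℕ} (hx : x ∈ fockIndex n m) (q : Fin k) :
    branch n k m' (x, q) ∈ fockIndex (n + 1) m' := by
  obtain ⟨h1, h2⟩ := mem_fockIndex.1 hx
  have h3 := mul_add_lt q h2
  rw [← hm _ (card_le_of_subset_range h1)] at h3
  rw [mem_fockIndex, Finset.range_add_one]
  unfold branch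
  split_ifs with h
  · exact ⟨h1.trans (Finset.subset_insert _ _), h⟩
  · refine ⟨Finset.insert_subset_insert _ h1, ?_⟩
    simp only at h
    rw [Finset.card_insert_of_notMem (notMem_of_subset_range h1)]
    simp only
    omega

theorem exists_branch_eq (hm : ∀ j ≤ n, m' j + m' (j + 1) = k * m j)
    {y : Σ _ : Finset ℕ, ℕ} (hy : y ∈ fockIndex (n + 1) m') :
    ∃ x ∈ fockIndex n m, ∃ q : Fin k, branch n k m' (x, q) = y := by
  obtain ⟨B, t⟩ := y
  obtain ⟨h1, h2⟩ := mem_fockIndex.1 hy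
  simp only at h1 h2
  obtain ⟨A, v, hA, hv, hb⟩ : ∃ (A : Finset ℕ) (v : ℕ), A ⊆ Finset.range n ∧
      v < k * m A.card ∧ (if v < m' A.card then (⟨A, v⟩ : Σ _ : Finset ℕ, ℕ) else
        ⟨insert n A, v - m' A.card⟩) = ⟨B, t⟩ := by
    rw [Finset.range_add_one] at h1
    by_cases hn : n ∈ B
    · have hA : B.erase n ⊆ Finset.range n := Finset.subset_insert_iff.1 h1
      have hc := Finset.card_erase_add_one hn
      refine ⟨B.erase n, t + m' (B.erase n).card, hA, ?_, ?_⟩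
      · rw [← hm _ (card_le_of_subset_range hA), hc]
        omega
      · rw [if_neg (by omega), Finset.insert_erase hn, Nat.add_sub_cancel]
    · have hA : B ⊆ Finset.range n := (Finset.subset_insert_iff_of_notMem hn).1 h1
      refine ⟨B, t, hA, ?_, by rw [if_pos h2]⟩
      rw [← hm _ (card_le_of_subset_range hA)]
      omega
  have hk : 0 < k := Nat.pos_of_mul_pos_right (Nat.zero_lt_of_lt hv)
  refine ⟨⟨A, v / k⟩, mem_fockIndex.2 ⟨hA, Nat.div_lt_of_lt_mul hv⟩,
    ⟨v % k, Nat.mod_lt _ hk⟩, ?_⟩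
  rw [← hb, branch]
  simp only [Nat.div_add_mod']

/-- Entries between subsets with and without `n` vanish, as do those between different
cardinalities; in the remaining cases the copy number determines both the old copy and `q`. -/
theorem multCoeff_branch {a b : ℕ} (ha : a < n) (hb : b < n) {x y : Σ _ : Finset ℕ, ℕ}
    (hx : x ∈ fockIndex n m) (hy : y ∈ fockIndex n m) (q r : Fin k) :
    multCoeff a b (branch n k m' (x, q)) (branch n k m' (y, r)) =
      if q = r then multCoeff a b x y else 0 := by
  obtain ⟨A, s⟩ := x
  obtain ⟨B, t⟩ := y
  have hA := notMem_of_subset_range (mem_fockIndex.1 hx).1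
  have hB := notMem_of_subset_range (mem_fockIndex.1 hy).1
  simp only at hA hB
  by_cases hcard : A.card = B.card
  · by_cases hv : s * k + q = t * k + r
    · obtain ⟨rfl, rfl⟩ := mul_add_inj hv
      unfold branch multCoeff
      simp only [hcard]
      split_ifs
      · rfl
      · exact fockCoeff_insert ha hb hA hB
      · simp_all
    · have h1 : (if q = r then multCoeff a b ⟨A, s⟩ ⟨B, t⟩ else 0) = 0 := by
        unfold multCoeff
        split_ifs <;> simp_all
      rw [h1]
      unfold branch multCoeff
      simp only [hcard]
      by_cases hs : s * k + q < m' B.card <;> by_cases ht : t * k + r < m' B.card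
      · simp [hs, ht, hv]
      · rw [if_pos hs, if_neg ht, fockCoeff_eq_zero_of_mem (n := n) ha hb (by simp [hA])]
        simp
      · rw [if_neg hs, if_pos ht, fockCoeff_eq_zero_of_mem (n := n) ha hb (by simp [hB])]
        simp
      · rw [if_neg hs, if_neg ht, if_neg (by simp only; omega)]
  · have h0 : fockCoeff a b A B = 0 := by
      by_contra hne
      exact hcard (card_eq_of_fockCoeff_ne_zero hne)
    have h1 : (if q = r then multCoeff a b ⟨A, s⟩ ⟨B, t⟩ else 0) = 0 := by
      simp [multCoeff, h0]
    rw [h1]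
    unfold branch multCoeff
    by_cases hs : s * k + q < m' A.card <;> by_cases ht : t * k + r < m' B.card
    · simp [hs, ht, h0]
    · simp [hs, ht, fockCoeff_eq_zero_of_mem (A := A) (B := insert n B) ha hb (by simp [hA])]
    · simp [hs, ht, fockCoeff_eq_zero_of_mem (A := insert n A) (B := B) ha hb (by simp [hB])]
    · simp [hs, ht, fockCoeff_insert ha hb hA hB, h0]

theorem branch_injOn {x y : Σ _ : Finset ℕ, ℕ} (hx : x ∈ fockIndex n m) (hy : y ∈ fockIndex n m)
    {q r : Fin k} (h : branch n k m' (x, q) = branch n k m' (y, r)) : x = y ∧ q = r := by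
  obtain ⟨A, s⟩ := x
  obtain ⟨B, t⟩ := y
  have hA := notMem_of_subset_range (mem_fockIndex.1 hx).1
  have hB := notMem_of_subset_range (mem_fockIndex.1 hy).1
  suffices H : A = B ∧ s * k + q = t * k + r by
    obtain ⟨rfl, h'⟩ := H
    obtain ⟨rfl, rfl⟩ := mul_add_inj h'
    exact ⟨rfl, rfl⟩
  have hf := congrArg Sigma.fst h
  have hs := congrArg Sigma.snd h
  unfold branch at hf hs
  simp only at hA hB hf hs
  by_cases h1 : s * k + q < m' A.card <;> by_cases h2 : t * k + r < m' B.card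
  · rw [if_pos h1, if_pos h2] at hf hs
    exact ⟨hf, hs⟩
  · rw [if_pos h1, if_neg h2] at hf
    simp only at hf
    exact (hA (by rw [hf]; simp)).elim
  · rw [if_neg h1, if_pos h2] at hf
    simp only at hf
    exact (hB (by rw [← hf]; simp)).elim
  · rw [if_neg h1, if_neg h2] at hf hs
    have hAB : A = B := by
      have := congrArg (fun C => C.erase n) hf
      simpa [Finset.erase_insert, hA, hB] using this
    subst hAB
    simp only at hs
    exact ⟨rfl, by omega⟩

end Branch

end FockModule

/-! ### Assembling the infinite system of matrix units -/

section Growth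

variable {L : Type*} [LieRing L] [LieAlgebra ℂ L]

/-- Reindexing the lifted units along the bijection `branch` turns the block-diagonal action of
`gl(n)` into the restriction of an action of `gl(n + 1)`. -/
theorem exists_fockElement_eq {n k : ℕ} {m m' : ℕ → ℕ}
    (hm : ∀ j ≤ n, m' j + m' (j + 1) = k * m j)
    {z : (Σ _ : Finset ℕ, ℕ) → (Σ _ : Finset ℕ, ℕ) → L}
    {z' : fockIndex n m × Fin k → fockIndex n m × Fin k → L}
    (hz : ∀ x y : fockIndex n m, z x y = ∑ s, z' (x, s) (y, s)) :
    ∃ (z'' : (Σ _ : Finset ℕ, ℕ) → (Σ _ : Finset ℕ, ℕ) → L)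
      (f : fockIndex (n + 1) m' → fockIndex n m × Fin k), Function.Injective f ∧
      (∀ x y : fockIndex (n + 1) m', z'' x y = z' (f x) (f y)) ∧
      ∀ a b, a < n → b < n → fockElement (n + 1) m' z'' a b = fockElement n m z a b := by
  let e : fockIndex n m × Fin k ≃ fockIndex (n + 1) m' := Equiv.ofBijective
    (fun p => ⟨branch n k m' (p.1, p.2), branch_mem_fockIndex hm p.1.2 p.2⟩) (by
      constructor
      · rintro ⟨x, q⟩ ⟨y, r⟩ h
        obtain ⟨h1, h2⟩ := branch_injOn x.2 y.2 (Subtype.ext_iff.1 h)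
        exact Prod.ext (Subtype.ext h1) h2
      · rintro ⟨y, hy⟩
        obtain ⟨x, hx, q, h⟩ := exists_branch_eq hm hy
        exact ⟨(⟨x, hx⟩, q), Subtype.ext h⟩)
  let z'' : (Σ _ : Finset ℕ, ℕ) → (Σ _ : Finset ℕ, ℕ) → L := fun x y =>
    if h : x ∈ fockIndex (n + 1) m' ∧ y ∈ fockIndex (n + 1) m' then
      z' (e.symm ⟨x, h.1⟩) (e.symm ⟨y, h.2⟩) else 0
  have hz'' : ∀ x y : fockIndex (n + 1) m', z'' x y = z' (e.symm x) (e.symm y) :=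
    fun x y => dif_pos ⟨x.2, y.2⟩
  refine ⟨z'', e.symm, e.symm.injective, hz'', fun a b ha hb => ?_⟩
  unfold fockElement blockSum
  rw [← e.sum_comp, Fintype.sum_prod_type]
  refine Finset.sum_congr rfl fun x _ => ?_
  calc ∑ q, ∑ y' : fockIndex (n + 1) m', multCoeff a b (e (x, q)) y' • z'' (e (x, q)) y'
      = ∑ q, ∑ y : fockIndex n m, multCoeff a b x y • z' (x, q) (y, q) := by
        refine Finset.sum_congr rfl fun q _ => ?_
        rw [← e.sum_comp, Fintype.sum_prod_type]
        refine Finset.sum_congr rfl fun y _ => ?_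
        rw [Finset.sum_eq_single q]
        · rw [hz'', e.symm_apply_apply, e.symm_apply_apply]
          congr 1
          exact (multCoeff_branch ha hb x.2 y.2 q q).trans (if_pos rfl)
        · intro r _ hr
          have : multCoeff a b (e (x, q)) (e (y, r)) = 0 :=
            (multCoeff_branch ha hb x.2 y.2 q r).trans (if_neg hr.symm)
          rw [this, zero_smul]
        · simp
    _ = ∑ y : fockIndex n m, multCoeff a b x y • z x y := by
        rw [Finset.sum_comm]
        exact Finset.sum_congr rfl fun y _ => by rw [hz, Finset.smul_sum]

theorem exists_le_prod {K : ℕ → ℕ} (hpos : ∀ i, 0 < K i) (hK : ∀ i₀, ∃ i ≥ i₀, 2 ≤ K i)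
    (i k₀ : ℕ) : ∃ n, k₀ ≤ ∏ t ∈ Finset.range n, K (i + t) := by
  induction k₀ with
  | zero => exact ⟨0, Nat.zero_le _⟩
  | succ k₀ ih =>
    obtain ⟨n, hn⟩ := ih
    obtain ⟨j, hj, h2⟩ := hK (i + n)
    obtain ⟨t, rfl⟩ := Nat.exists_eq_add_of_le hj
    refine ⟨n + t + 1, ?_⟩
    rw [Finset.prod_range_succ, Finset.prod_range_add, ← add_assoc]
    have h1 : 0 < ∏ t ∈ Finset.range n, K (i + t) := Finset.prod_pos fun _ _ => hpos _
    have h3 : 0 < ∏ s ∈ Finset.range t, K (i + (n + s)) := Finset.prod_pos fun _ _ => hpos _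
    have h4 := Nat.mul_le_mul (Nat.mul_le_mul_left (∏ t ∈ Finset.range n, K (i + t)) h3) h2
    omega

variable {S : ℕ → LieSubalgebra ℂ L} {d : ℕ → ℕ}
  {ρ : ∀ i, S i →ₗ⁅ℂ⁆ Module.End ℂ (Fin (d i) → ℂ)} {K : ℕ → ℕ}

/-- The case of a chain in which the natural module is repeated infinitely often. -/
theorem IsDiagonalChain.exists_isGlUnits_of_frequently_two_le (hρ : IsDiagonalChain S d ρ K)
    (hK : ∀ i₀, ∃ i ≥ i₀, 2 ≤ K i) : ∃ z : ℕ → ℕ → L, IsGlUnits z := by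
  obtain ⟨f, hf⟩ := exists_seq_of_step
    (α := ℕ × (ℕ → ℕ) × ((Σ _ : Finset ℕ, ℕ) → (Σ _ : Finset ℕ, ℕ) → L))
    (fun n x => IsMomentSystem n x.2.1 ∧
      Stage ρ x.1 fun a b : fockIndex n x.2.1 => x.2.2 a b)
    (fun n x x' => ∀ a b, a < n → b < n →
      fockElement (n + 1) x'.2.1 x'.2.2 a b = fockElement n x.2.1 x.2.2 a b) (by
      -- The start is `n = 0`: one copy of `Λ⁰(ℂ⁰)`, that is, a single matrix unit, which needs a
      -- natural module of dimension two.
      obtain ⟨i, -, hi⟩ := hρ.unbounded 2 0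
      obtain ⟨z, hz, -⟩ := (stage_of_isEmpty (ρ := ρ) i
        (fun _ _ => 0 : Fin 0 → Fin 0 → L)).extend hρ (by simpa using hi)
      refine ⟨(i, fun _ => 1, fun _ _ => z none none), isMomentSystem_zero,
        hz.comp_injective (f := fun _ => none) fun x y _ => ?_⟩
      have hx := mem_fockIndex.1 x.2
      have hy := mem_fockIndex.1 y.2
      simp only [Finset.range_zero, Finset.subset_empty, Nat.lt_one_iff] at hx hy
      exact Subtype.ext (Sigma.ext (hx.1.trans hy.1.symm) (heq_of_eq (hx.2.trans hy.2.symm)))) (by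
      rintro n ⟨i, m, z⟩ ⟨hm, hz⟩
      obtain ⟨k₀, hk₀⟩ := hm.exists_step
      -- The recurrence is solved for the exact total multiplicity of the next `t` inclusions, with
      -- `t` taken so that it reaches `k₀`.
      obtain ⟨t, ht⟩ := exists_le_prod hρ.pos hK i k₀
      obtain ⟨m', hm', hmm'⟩ := hk₀ _ ht
      obtain ⟨z', hz', hzz'⟩ := hz.add hρ t rfl
      obtain ⟨z'', f, hf, hz'', h⟩ := exists_fockElement_eq hmm' hzz'
      refine ⟨(i + t, m', z''), ⟨hm', ?_⟩, h⟩
      simp only [hz'']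
      exact hz'.comp_injective hf)
  exact exists_isGlUnits_of_coherent (fun n => fockElement n (f n).2.1 (f n).2.2)
    (fun n => isGlUnits_fockElement ((hf n).1.2.isGlUnits hρ) fun h => (hf n).1.1.pos h)
    fun n => (hf n).2

theorem IsDiagonalChain.exists_isGlUnits (hρ : IsDiagonalChain S d ρ K) :
    ∃ z : ℕ → ℕ → L, IsGlUnits z := by
  by_cases h : ∀ i₀, ∃ i ≥ i₀, 2 ≤ K i
  · exact hρ.exists_isGlUnits_of_frequently_two_le h
  · push Not at h
    obtain ⟨i₀, h⟩ := h
    exact hρ.exists_isGlUnits_of_eventually_one (i₀ := i₀) fun i hi => by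
      have := h i hi
      have := hρ.pos i
      omega

end Growth

end DiagonalLie

theorem mainTheorem9 {𝔰 : Type*} [LieRing 𝔰] [LieAlgebra ℂ 𝔰]
    (hdiag : DiagonalLie.IsDiagonal 𝔰) (hinf : ¬ FiniteDimensional ℂ 𝔰) :
    (∃ φ : DiagonalLie.slInf →ₗ⁅ℂ⁆ 𝔰, Function.Injective φ) ∧
    (∃ φ : DiagonalLie.soInf →ₗ⁅ℂ⁆ 𝔰, Function.Injective φ) ∧
    (∃ φ : DiagonalLie.spInf →ₗ⁅ℂ⁆ 𝔰, Function.Injective φ) := by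
  obtain ⟨S, d, ρ, K, h⟩ := hdiag.exists_isDiagonalChain hinf
  obtain ⟨z, hz⟩ := h.exists_isGlUnits
  exact DiagonalLie.exists_lieHom_of_isGlUnits hz
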